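/- Let $d\in\mathbb N$, $H\in(1/3,1/2)$ and $0<\mu<H$. Let $\{\eta_k^i;\ k\ge 1,\ 1\le i\le d\}$ be independent real random variables on a probability space, all with the law of a random variable $\eta$ such that $E(\eta)=0$, $E(\eta^2)=1$ and $|\eta|\le k_\eta$ almost surely for some constant $k_\eta$. For $\varepsilon>0$, $1\le i,j\le d$ and $s,t\in[0,1]$ set $$\theta^{i,\varepsilon}(r)=\frac1\varepsilon\sum_{k=1}^{\infty}\eta_k^i\,\mathbf 1_{[k-1,k)}\Big(\frac{r}{\varepsilon^2}\Big),\qquad X^{i,\varepsilon}(t)=\int_0^t (t+\varepsilon-r)^{H-\frac12}\,\theta^{i,\varepsilon}(r)\,dr,$$ $$\mathbf X^{2,\varepsilon}_{st}(i,j)=\int_s^t\big(X^{j,\varepsilon}_u-X^{j,\varepsilon}_s\big)\,dX^{i,\varepsilon}_u,$$ where the last integral is an (oriented) Lebesgue--Stieltjes integral; write $X^\varepsilon=(X^{i,\varepsilon})_{i}$ and $\mathbf X^{2,\varepsilon}=(\mathbf X^{2,\varepsilon}(i,j))_{i,j}$. For a finite-dimensional Euclidean space $V$ and $\nu>0$,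 let $\mathcal C_2^{\nu}(V)$ be the space of continuous $f:[0,1]^2\to V$ which vanish on the diagonal and satisfy $\|f\|_\nu:=\sup_{s\neq t}|f_{st}|/|t-s|^{\nu}<\infty$, normed by $\|\cdot\|_\nu$, and let $\mathcal C_1^{\nu}(V)$ be the space of continuous $g:[0,1]\to V$ with $\delta g\in\mathcal C_2^\nu(V)$, where $(\delta g)_{st}=g_t-g_s$, normed by $|g_0|+\|\delta g\|_\nu$. Then, for every $\varepsilon>0$, the paths $X^{i,\varepsilon}$ have bounded variation on $[0,1]$, the pair $(X^\varepsilon,\mathbf X^{2,\varepsilon})$ takes its values in $\mathcal C_1^{\mu}(\mathbb R^d)\times\mathcal C_2^{2\mu}(\mathbb R^{d\times d})$ and is a random variable for the Borel $\sigma$-algebra of this normed space, and the family of the laws of $(X^\varepsilon,\mathbf X^{2,\varepsilon})$, $\varepsilon>0$, is tight in $\mathcal C_1^{\mu}(\mathbb R^d)\times\mathcal C_2^{2\mu}(\mathbb R^{d\times d})$: for every $\rho>0$ there is a compact subset $K$ of this space such that $P\big((X^\varepsilon,\mathbf X^{2,\varepsilon})\notin K\big)\le\rho$ for all $\varepsilon>0$.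 -/

import Mathlib

open MeasureTheory ProbabilityTheory Set
open scoped unitInterval

noncomputable section

/-! ### Hölder spaces on `[0,1]` and on `[0,1]²` -/

/-- The increment `(δ g)_{st} = g_t - g_s` of a continuous path. -/
def increment (V : Type*) [NormedAddCommGroup V] [NormedSpace ℝ V] :
    C(I, V) →ₗ[ℝ] C(I × I, V) where
  toFun g := ⟨fun p => g p.2 - g p.1, by fun_prop⟩
  map_add' f g := by ext p; simp; abel
  map_smul' c g := by ext p; simp [smul_sub]

/-- `C₂^ν([0,1]; V)`: continuous functions `f` on `[0,1]²` for which
`sup_{s,t} |f_{st}| / |t - s|^ν` is finite (so that, for `ν > 0`, `f_{ss} = 0`). -/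
def holderTwo (ν : ℝ) (V : Type*) [NormedAddCommGroup V] [NormedSpace ℝ V] :
    Submodule ℝ C(I × I, V) where
  carrier := {f | ∃ C : ℝ, ∀ s t : I, ‖f (s, t)‖ ≤ C * |(t : ℝ) - s| ^ ν}
  zero_mem' := ⟨0, by simp⟩
  add_mem' := by
    rintro f g ⟨C, hC⟩ ⟨D, hD⟩
    refine ⟨C + D, fun s t => ?_⟩
    calc ‖(f + g) (s, t)‖ ≤ ‖f (s, t)‖ + ‖g (s, t)‖ := norm_add_le _ _
      _ ≤ (C + D) * |(t : ℝ) - s| ^ ν := by linarith [hC s t, hD s t]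
  smul_mem' := by
    rintro c f ⟨C, hC⟩
    refine ⟨‖c‖ * C, fun s t => ?_⟩
    calc ‖(c • f) (s, t)‖ = ‖c‖ * ‖f (s, t)‖ := norm_smul _ _
      _ ≤ ‖c‖ * (C * |(t : ℝ) - s| ^ ν) :=
        mul_le_mul_of_nonneg_left (hC s t) (norm_nonneg c)
      _ = ‖c‖ * C * |(t : ℝ) - s| ^ ν := by ring

/-- `C₁^ν([0,1]; V)`: continuous paths whose increment lies in `C₂^ν([0,1]; V)`. -/
def holderOne (ν : ℝ) (V : Type*) [NormedAddCommGroup V] [NormedSpace ℝ V] :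
    Submodule ℝ C(I, V) :=
  (holderTwo ν V).comap (increment V)

section HolderNorm

variable {ν : ℝ} {V : Type*} [NormedAddCommGroup V] [NormedSpace ℝ V]

/-- `‖f‖_ν = sup_{s,t} |f_{st}| / |t - s|^ν`. -/
def holderNorm (ν : ℝ) (f : C(I × I, V)) : ℝ :=
  ⨆ p : I × I, ‖f p‖ / |(p.2 : ℝ) - p.1| ^ ν

theorem holderNorm_bddAbove {f : C(I × I, V)} (hf : f ∈ holderTwo ν V) :
    BddAbove (range fun p : I × I => ‖f p‖ / |(p.2 : ℝ) - p.1| ^ ν) := by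
  obtain ⟨C, hC⟩ := hf
  refine ⟨max C 0, ?_⟩
  rintro _ ⟨⟨s, t⟩, rfl⟩
  have h0 : 0 ≤ |(t : ℝ) - s| ^ ν := by positivity
  exact div_le_of_le_mul₀ h0 (le_max_right _ _)
    ((hC s t).trans (mul_le_mul_of_nonneg_right (le_max_left _ _) h0))

theorem le_holderNorm {f : C(I × I, V)} (hf : f ∈ holderTwo ν V) (p : I × I) :
    ‖f p‖ / |(p.2 : ℝ) - p.1| ^ ν ≤ holderNorm ν f :=
  le_ciSup (holderNorm_bddAbove hf) p

theorem holderNorm_nonneg (f : C(I × I, V)) : 0 ≤ holderNorm ν f :=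
  Real.iSup_nonneg fun _ => by positivity

theorem holderNorm_zero : holderNorm ν (0 : C(I × I, V)) = 0 := by
  simp [holderNorm]

theorem holderNorm_neg (f : C(I × I, V)) : holderNorm ν (-f) = holderNorm ν f := by
  simp [holderNorm]

theorem holderNorm_add_le {f g : C(I × I, V)} (hf : f ∈ holderTwo ν V)
    (hg : g ∈ holderTwo ν V) : holderNorm ν (f + g) ≤ holderNorm ν f + holderNorm ν g := by
  refine ciSup_le fun p => ?_
  have h : ‖(f + g) p‖ / |(p.2 : ℝ) - p.1| ^ ν
      ≤ ‖f p‖ / |(p.2 : ℝ) - p.1| ^ ν + ‖g p‖ / |(p.2 : ℝ) - p.1| ^ ν := by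
    rw [← add_div]
    exact div_le_div_of_nonneg_right (norm_add_le _ _) (by positivity)
  linarith [le_holderNorm hf p, le_holderNorm hg p]

theorem eq_zero_of_holderNorm_eq_zero {f : C(I × I, V)} (hf : f ∈ holderTwo ν V)
    (h : holderNorm ν f = 0) : f = 0 := by
  ext p
  have h1 : ‖f p‖ / |(p.2 : ℝ) - p.1| ^ ν = 0 :=
    le_antisymm (h ▸ le_holderNorm hf p) (by positivity)
  obtain ⟨C, hC⟩ := hf
  rcases div_eq_zero_iff.1 h1 with h2 | h2
  · simpa using h2
  · have h3 := hC p.1 p.2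
    rw [h2, mul_zero] at h3
    simpa using h3

/-- The space `C₂^ν([0,1]; V)` as a type of its own, so that it does not inherit the sup norm. -/
def HolderTwo (ν : ℝ) (V : Type*) [NormedAddCommGroup V] [NormedSpace ℝ V] : Type _ :=
  {f : C(I × I, V) // f ∈ holderTwo ν V}

/-- The space `C₁^ν([0,1]; V)` as a type of its own, so that it does not inherit the sup norm. -/
def HolderOne (ν : ℝ) (V : Type*) [NormedAddCommGroup V] [NormedSpace ℝ V] : Type _ :=
  {g : C(I, V) // g ∈ holderOne ν V}

instance : AddCommGroup (HolderTwo ν V) := inferInstanceAs (AddCommGroup (holderTwo ν V))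

instance : AddCommGroup (HolderOne ν V) := inferInstanceAs (AddCommGroup (holderOne ν V))

/-- `C₂^ν` is normed by `‖·‖_ν`. -/
instance : NormedAddCommGroup (HolderTwo ν V) :=
  AddGroupNorm.toNormedAddCommGroup
    { toFun := fun f => holderNorm ν f.1
      map_zero' := holderNorm_zero
      add_le' := fun f g => holderNorm_add_le f.2 g.2
      neg' := fun f => holderNorm_neg f.1
      eq_zero_of_map_eq_zero' := fun f h =>
        Subtype.ext (eq_zero_of_holderNorm_eq_zero f.2 h) }

/-- `C₁^ν` is normed by `|g_0| + ‖δ g‖_ν`; the induced distance on the paths with a prescribed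
initial value is `‖δ (g - h)‖_ν`. -/
instance : NormedAddCommGroup (HolderOne ν V) :=
  AddGroupNorm.toNormedAddCommGroup
    { toFun := fun g => ‖g.1 0‖ + holderNorm ν (increment V g.1)
      map_zero' := by
        change ‖(0 : C(I, V)) 0‖ + holderNorm ν (increment V 0) = 0
        simp [holderNorm_zero]
      add_le' := fun f g => by
        change ‖f.1 0 + g.1 0‖ + holderNorm ν (increment V (f.1 + g.1)) ≤ _
        have h1 := norm_add_le (f.1 0) (g.1 0)
        have h2 := holderNorm_add_le (show increment V f.1 ∈ holderTwo ν V from f.2)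
          (show increment V g.1 ∈ holderTwo ν V from g.2)
        rw [map_add]
        linarith
      neg' := fun f => by
        change ‖-(f.1 0)‖ + holderNorm ν (increment V (-f.1)) = _
        rw [map_neg, holderNorm_neg, norm_neg]
      eq_zero_of_map_eq_zero' := fun f h => by
        have h0 := norm_nonneg (f.1 0)
        have h1 := holderNorm_nonneg (ν := ν) (increment V f.1)
        have h2 : f.1 0 = 0 := norm_eq_zero.1 (by linarith)
        have h3 := eq_zero_of_holderNorm_eq_zero
          (show increment V f.1 ∈ holderTwo ν V from f.2) (by linarith)
        apply Subtype.ext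
        ext t
        have h4 : f.1 t - f.1 0 = 0 := DFunLike.congr_fun h3 ((0 : I), t)
        rw [h2, sub_zero] at h4
        exact h4 }

end HolderNorm

/-- The space `C₁^μ([0,1]; ℝ^d) × C₂^{2μ}([0,1]; ℝ^{d×d})`. -/
def RoughSpace (d : ℕ) (μ : ℝ) : Type :=
  HolderOne μ (EuclideanSpace ℝ (Fin d)) × HolderTwo (2 * μ) (EuclideanSpace ℝ (Fin d × Fin d))

instance (d : ℕ) (μ : ℝ) : NormedAddCommGroup (RoughSpace d μ) :=
  inferInstanceAs (NormedAddCommGroup (HolderOne μ (EuclideanSpace ℝ (Fin d)) ×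
    HolderTwo (2 * μ) (EuclideanSpace ℝ (Fin d × Fin d))))

/-- `RoughSpace` carries the Borel σ-algebra of its (non-separable) norm topology. -/
instance (d : ℕ) (μ : ℝ) : MeasurableSpace (RoughSpace d μ) := borel _

instance (d : ℕ) (μ : ℝ) : BorelSpace (RoughSpace d μ) := ⟨rfl⟩

/-! ### Lebesgue–Stieltjes integrals on `[0,1]` -/

/-- The Lebesgue–Stieltjes signed measure `dg` on `[0,1]` of a function `g` of bounded variation
(and `0` if `g` is not of bounded variation). -/
def stieltjesMeasure (g : I → ℝ) : SignedMeasure I :=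
  open scoped Classical in
  if h : BoundedVariationOn g univ then h.vectorMeasure else 0

/-- The oriented Lebesgue–Stieltjes integral `∫_s^t f dg`. -/
def stieltjesIntegral (f g : I → ℝ) (s t : I) : ℝ :=
  if s ≤ t then ∫ᵛ u in Ioc s t, f u ∂•(stieltjesMeasure g)
  else -∫ᵛ u in Ioc t s, f u ∂•(stieltjesMeasure g)

/-! ### The approximating processes

The random variables are indexed from `0`: `η i k` stands for `η^i_{k+1}`. -/

section Processes

variable {Ω : Type*} {d : ℕ}

/-- `θ^{i,ε}(r) = ε⁻¹ ∑_{k ≥ 1} η^i_k 1_{[k-1,k)}(r / ε²)`. -/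
def donskerNoise (η : Fin d → ℕ → Ω → ℝ) (ε : ℝ) (ω : Ω) (i : Fin d) (r : ℝ) : ℝ :=
  1 / ε * ∑' k : ℕ, η i k ω * (Ico (k : ℝ) (k + 1)).indicator 1 (r / ε ^ 2)

/-- `X^{i,ε}(t) = ∫_0^t (t + ε - r)^{H - 1/2} θ^{i,ε}(r) dr`. -/
def donskerPath (H : ℝ) (η : Fin d → ℕ → Ω → ℝ) (ε : ℝ) (ω : Ω) (i : Fin d) (t : I) : ℝ :=
  ∫ r in (0 : ℝ)..t, ((t : ℝ) + ε - r) ^ (H - 1 / 2) * donskerNoise η ε ω i r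

/-- The Lévy area `X^{2,ε}_{st}(i,j) = ∫_s^t (X^{j,ε}_u - X^{j,ε}_s) dX^{i,ε}_u`. -/
def donskerArea (H : ℝ) (η : Fin d → ℕ → Ω → ℝ) (ε : ℝ) (ω : Ω) (i j : Fin d) (s t : I) : ℝ :=
  stieltjesIntegral (fun u => donskerPath H η ε ω j u - donskerPath H η ε ω j s)
    (donskerPath H η ε ω i) s t

end Processes

end

/-!
The path `X^ε` driven by the noise `θ^ε` is Lipschitz: it is the primitive of a bounded function,
here called its velocity. Lebesgue–Stieltjes integrals against it are therefore ordinary integrals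
against the velocity (`stieltjesIntegral_eq_intervalIntegral`), and by Fubini an integral `∫_s^t f
dX^ε` is a finite linear form in the variables `η_k`. Bessel's inequality on the cells `[kε²,
(k+1)ε²)` bounds the sum of the squared coefficients by the squared `L²` norm of a dual kernel
(`sum_cellCoeff_sq_le`). If `f` has size `F` and `b`-Hölder constant `M`, with `b + H > 1/2`, this
is at most a constant times `(F + M (t-s)^b)² (t-s)^{2H}`, uniformly in `ε`
(`integral_adjointWeight_sq_le`).

The `η_k` are bounded and centred, hence sub-Gaussian by Hoeffding's lemma, and so are the linear
forms. With `f = 1` this controls the increments of the path over dyadic intervals of length `h`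
at scale `R h^b` for any `b < H`, with a probability of failure which is summable over all dyadic
intervals and tends to `0` as `R → ∞` (`measure_not_dyadicPathBound_le`). For two distinct, hence
independent, components, the area is a linear form in one of them conditionally on the other, with
an integrand whose Hölder norm is controlled on the event just described; this gives the scale `R²
h^{2b}` for the dyadic areas (`measure_not_dyadicAreaBound_le`). Dyadic chaining
(`abs_le_of_dyadic`), combined with Chen's relation for the area, carries the bounds over to all
intervals. The diagonal areas are half of squared increments (`noiseArea_diag`).

For `μ < b < H`, a set of paths from `0` with bounded `b`-Hölder constant is compact in `C₁^μ`,
and a set of areas bounded at order `2b` and with the bounds of Chen's relation is compact in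
`C₂^{2μ}`, by Arzelà–Ascoli and interpolation between Hölder norms (`isCompact_holderOne`,
`isCompact_holderTwo`); this yields tightness. The lifted process is Borel measurable, although
the Hölder spaces are not separable, because it is a continuous function of finitely many of the
`η_k` (`exists_measurable_lift`).
-/

noncomputable section

/-! ### Lebesgue–Stieltjes integrals against a path with bounded density -/

section Stieltjes

variable {φ : ℝ → ℝ} {M c : ℝ} {g : I → ℝ}

theorem lipschitzWith_of_density (hφM : ∀ u ∈ Icc (0 : ℝ) 1, |φ u| ≤ M)
    (hφ : IntegrableOn φ (Icc 0 1))
    (hg : ∀ t : I, g t = c + ∫ u in (0 : ℝ)..t, φ u) :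
    LipschitzWith M.toNNReal g := by
  have hM : 0 ≤ M := (abs_nonneg _).trans (hφM 0 (by simp))
  have hint : ∀ t : I, IntervalIntegrable φ volume 0 t := fun t =>
    (hφ.mono_set (uIcc_subset_Icc (by simp) t.2)).intervalIntegrable
  refine LipschitzWith.of_dist_le_mul fun s t => ?_
  rw [Real.dist_eq, hg, hg, add_sub_add_left_eq_sub,
    intervalIntegral.integral_interval_sub_left (hint s) (hint t), Real.coe_toNNReal _ hM]
  have h : ∀ u ∈ uIoc (t : ℝ) s, ‖φ u‖ ≤ M := fun u hu =>
    hφM u (uIcc_subset_Icc t.2 s.2 (uIoc_subset_uIcc hu))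
  exact intervalIntegral.norm_integral_le_of_norm_le_const h

theorem LipschitzWith.boundedVariationOn_unitInterval {K : NNReal} (hg : LipschitzWith K g) :
    BoundedVariationOn g univ := by
  refine hg.comp_boundedVariationOn (g := id) (s := univ) ?_
  have h : BoundedVariationOn (Subtype.val : I → ℝ) univ := by
    apply MonotoneOn.boundedVariationOn (C := 1)
    · exact fun _ _ _ _ h => h
    · exact fun x _ => abs_le.2 ⟨by linarith [x.2.1], x.2.2⟩
  simpa [BoundedVariationOn, eVariationOn, Subtype.edist_eq] using h

/-- The pairing used in `stieltjesIntegral` and the scalar pairing, for which Mathlib computes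
integrals against signed measures, agree on `ℝ`. -/
theorem integral_flip_lsmul_eq {X : Type*} [MeasurableSpace X] (f : X → ℝ)
    (m : SignedMeasure X) : (∫ᵛ u, f u ∂•m) = ∫ᵛ u, f u ∂<•m := by
  congr 1
  ext
  simp

theorem setIntegral_comap_unitInterval (f : ℝ → ℝ) (s t : I) (hst : s ≤ t) :
    ∫ u in Ioc s t, f u ∂(volume.comap (Subtype.val : I → ℝ)) = ∫ u in (s : ℝ)..t, f u := by
  have hme : MeasurableEmbedding (Subtype.val : I → ℝ) :=
    MeasurableEmbedding.subtype_coe measurableSet_Icc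
  have himage : (Subtype.val : I → ℝ) ⁻¹' (Ioc (s : ℝ) t) = Ioc s t := rfl
  rw [intervalIntegral.integral_of_le hst, ← himage, ← hme.setIntegral_map,
    map_comap_subtype_coe measurableSet_Icc, Measure.restrict_restrict measurableSet_Ioc,
    inter_eq_left.2 (Ioc_subset_Icc_self.trans (Icc_subset_Icc s.2.1 t.2.2))]

theorem rightLim_eq_of_continuous (hg : Continuous g) (t : I) : Function.rightLim g t = g t := by
  rcases (nhdsWithin (t) (Ioi t)).eq_or_neBot with h | h
  · exact rightLim_eq_of_eq_bot g h
  · exact rightLim_eq_of_tendsto (hg.tendsto t |>.mono_left nhdsWithin_le_nhds)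

theorem leftLim_eq_of_continuous (hg : Continuous g) (t : I) : Function.leftLim g t = g t := by
  rcases (nhdsWithin (t) (Iio t)).eq_or_neBot with h | h
  · exact leftLim_eq_of_eq_bot g h
  · exact leftLim_eq_of_tendsto (hg.tendsto t |>.mono_left nhdsWithin_le_nhds)

theorem integrable_comap_unitInterval (hφ : IntegrableOn φ (Icc 0 1)) :
    Integrable (fun u : I => φ u) (volume.comap (Subtype.val : I → ℝ)) := by
  have hme : MeasurableEmbedding (Subtype.val : I → ℝ) :=
    MeasurableEmbedding.subtype_coe measurableSet_Icc
  have h : Integrable φ ((volume.comap (Subtype.val : I → ℝ)).map Subtype.val) := by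
    rw [map_comap_subtype_coe measurableSet_Icc]
    exact hφ
  exact hme.integrable_map_iff.1 h

instance : IsFiniteMeasure (volume.comap (Subtype.val : I → ℝ)) := by
  constructor
  rw [comap_subtype_coe_apply measurableSet_Icc, Subtype.coe_image_univ]
  simp

/-- The Lebesgue–Stieltjes measure of `g = c + ∫ φ` is the signed measure `φ(u) du`. -/
theorem stieltjesMeasure_eq_withDensity (hφM : ∀ u ∈ Icc (0 : ℝ) 1, |φ u| ≤ M)
    (hφ : IntegrableOn φ (Icc 0 1))
    (hg : ∀ t : I, g t = c + ∫ u in (0 : ℝ)..t, φ u) :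
    stieltjesMeasure g = (volume.comap (Subtype.val : I → ℝ)).withDensityᵥ fun u : I => φ u := by
  have hL := lipschitzWith_of_density hφM hφ hg
  have hbv := hL.boundedVariationOn_unitInterval
  have hint : ∀ t : I, IntervalIntegrable φ volume 0 t := fun t =>
    (hφ.mono_set (uIcc_subset_Icc (by simp) t.2)).intervalIntegrable
  have hφI := integrable_comap_unitInterval hφ
  have hgsub : ∀ s t : I, g t - g s = ∫ u in (s : ℝ)..t, φ u := fun s t => by
    rw [hg, hg, add_sub_add_left_eq_sub,
      intervalIntegral.integral_interval_sub_left (hint t) (hint s)]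
  have hIoc : ∀ s t : I, s ≤ t → hbv.vectorMeasure (Ioc s t) =
      (volume.comap (Subtype.val : I → ℝ)).withDensityᵥ (fun u : I => φ u) (Ioc s t) := by
    intro s t hst
    rw [hbv.vectorMeasure_Ioc hst, withDensityᵥ_apply hφI measurableSet_Ioc,
      setIntegral_comap_unitInterval φ s t hst, rightLim_eq_of_continuous hL.continuous,
      rightLim_eq_of_continuous hL.continuous, hgsub]
  rw [stieltjesMeasure, dif_pos hbv]
  refine VectorMeasure.ext_of_generateFrom {S | ∃ s t : I, s < t ∧ Ioc s t = S} ?_ ?_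
    (isPiSystem_Ioc id id) ?_
  · rintro _ ⟨s, t, hst, rfl⟩
    exact hIoc s t hst.le
  · exact (BorelSpace.measurable_eq (α := I)).trans (borel_eq_generateFrom_Ioc I)
  -- the half-open intervals miss the point `0`, where a continuous path has no atom
  · have huniv : (univ : Set I) = {0} ∪ Ioc 0 1 := by
      ext x
      simp only [mem_univ, mem_union, mem_singleton_iff, mem_Ioc, true_iff]
      rcases eq_or_lt_of_le (unitInterval.nonneg' (t := x)) with h | h
      · exact Or.inl h.symm
      · exact Or.inr ⟨h, unitInterval.le_one'⟩
    have hdisj : Disjoint ({0} : Set I) (Ioc 0 1) := by simp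
    rw [huniv, VectorMeasure.of_union hdisj (measurableSet_singleton _) measurableSet_Ioc,
      VectorMeasure.of_union hdisj (measurableSet_singleton _) measurableSet_Ioc,
      hIoc 0 1 zero_le_one, hbv.vectorMeasure_singleton, rightLim_eq_of_continuous hL.continuous,
      leftLim_eq_of_continuous hL.continuous,
      withDensityᵥ_apply hφI (measurableSet_singleton _), sub_self]
    congr 1
    symm
    apply setIntegral_measure_zero
    rw [comap_subtype_coe_apply measurableSet_Icc]
    simp

/-- A Lebesgue–Stieltjes integral against `g = c + ∫ φ` is an interval integral against `φ`, for
both orientations. -/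
theorem stieltjesIntegral_eq_intervalIntegral (hφM : ∀ u ∈ Icc (0 : ℝ) 1, |φ u| ≤ M)
    (hφm : Measurable φ) (hφ : IntegrableOn φ (Icc 0 1))
    (hg : ∀ t : I, g t = c + ∫ u in (0 : ℝ)..t, φ u)
    {f : ℝ → ℝ} (hf : ContinuousOn f (Icc 0 1)) (s t : I) :
    stieltjesIntegral (fun u => f u) g s t = ∫ u in (s : ℝ)..t, f u * φ u := by
  set m := volume.comap (Subtype.val : I → ℝ) with hm
  have hφI := integrable_comap_unitInterval hφ
  have hfI : Continuous fun u : I => f u := hf.domRestrict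
  have hφmI : Measurable fun u : I => φ u := hφm.comp measurable_subtype_coe
  have hfin : ∀ ψ : I → ℝ, Integrable ψ m →
      IsFiniteMeasure (m.withDensity fun u => ENNReal.ofReal (ψ u)) := fun ψ hψ =>
    isFiniteMeasure_withDensity_ofReal hψ.2
  have h1 := hfin _ hφI
  have h2 := hfin _ hφI.neg
  have hbdd : ∀ μ : Measure I, [IsFiniteMeasure μ] → Integrable (fun u : I => f u) μ := by
    intro μ _
    exact (BoundedContinuousFunction.mkOfCompact ⟨_, hfI⟩).integrable μ
  have key : ∀ s t : I, s ≤ t →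
      ∫ᵛ u in Ioc s t, f u ∂•(stieltjesMeasure g) = ∫ u in (s : ℝ)..t, f u * φ u := by
    intro s t hst
    rw [integral_flip_lsmul_eq, stieltjesMeasure_eq_withDensity hφM hφ hg,
      withDensityᵥ_eq_withDensity_pos_part_sub_withDensity_neg_part hφI,
      VectorMeasure.restrict_sub, VectorMeasure.integral_sub_vectorMeasure,
      VectorMeasure.setIntegral_toSignedMeasure measurableSet_Ioc,
      VectorMeasure.setIntegral_toSignedMeasure measurableSet_Ioc,
      ← setIntegral_comap_unitInterval (fun u => f u * φ u) s t hst]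
    rw [setIntegral_withDensity_eq_setIntegral_toReal_smul (by fun_prop) (by simp) _
      measurableSet_Ioc, setIntegral_withDensity_eq_setIntegral_toReal_smul (by fun_prop) (by simp)
      _ measurableSet_Ioc, ← integral_sub]
    · refine setIntegral_congr_fun measurableSet_Ioc fun u _ => ?_
      simp only [smul_eq_mul]
      rw [← sub_mul, ENNReal.toReal_ofReal', ENNReal.toReal_ofReal',
        max_zero_sub_max_neg_zero_eq_self, mul_comm]
    · exact ((integrable_withDensity_iff_integrable_smul' (by fun_prop) (by simp)).1
        (hbdd _)).integrableOn
    · exact ((integrable_withDensity_iff_integrable_smul' (by fun_prop) (by simp)).1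
        (@hbdd _ h2)).integrableOn
    · refine VectorMeasure.Integrable.integrableOn ?_
      simpa [VectorMeasure.Integrable] using hbdd _
    · refine VectorMeasure.Integrable.integrableOn ?_
      have := @hbdd _ h2
      simpa [VectorMeasure.Integrable] using this
  unfold stieltjesIntegral
  split_ifs with h
  · exact key s t h
  · rw [key t s (le_of_not_ge h), intervalIntegral.integral_symm]
    ring

end Stieltjes

/-! ### The path as a linear functional of the noise -/

section Kernel

variable {H ε : ℝ} {z : ℕ → ℝ} {g ψ : ℝ → ℝ} {C : ℝ}

/-- The piecewise constant noise `ε⁻¹ z_k` on `[kε², (k+1)ε²)` driven by a sequence `z`. -/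
def noise (ε : ℝ) (z : ℕ → ℝ) (r : ℝ) : ℝ := 1 / ε * z ⌊r / ε ^ 2⌋₊

/-- The noise driven by the `k`-th unit sequence: `ε⁻¹` on the cell `[kε², (k+1)ε²)`. -/
def cell (ε : ℝ) (k : ℕ) (r : ℝ) : ℝ := if ⌊r / ε ^ 2⌋₊ = k then 1 / ε else 0

/-- The number of cells which meet `[0,1]`. -/
def cellCount (ε : ℝ) : ℕ := ⌊1 / ε ^ 2⌋₊ + 1

/-- The time derivative of the kernel `(u + ε - r)^{H - 1/2}`, restricted to the past `r < u`. -/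
def kernelDeriv (H ε u r : ℝ) : ℝ :=
  if r < u then (H - 1 / 2) * (u + ε - r) ^ (H - 3 / 2) else 0

/-- The density of the path with noise `z`: the path is the primitive of this function. The first
term comes from the value `ε ^ (H - 1/2)` of the kernel on the diagonal, which is finite because of
the shift by `ε`. -/
def velocity (H ε : ℝ) (z : ℕ → ℝ) (u : ℝ) : ℝ :=
  ε ^ (H - 1 / 2) * noise ε z u + ∫ r in Ioc (0 : ℝ) 1, kernelDeriv H ε u r * noise ε z r

/-- The dual kernel: `∫ g · velocity = ∫ adjointWeight g · noise` over `(0,1]`. -/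
def adjointWeight (H ε : ℝ) (g : ℝ → ℝ) (r : ℝ) : ℝ :=
  ε ^ (H - 1 / 2) * g r + ∫ u in Ioc (0 : ℝ) 1, g u * kernelDeriv H ε u r

/-- The coefficient of `z k` in `∫ ψ · noise`. -/
def cellCoeff (ε : ℝ) (ψ : ℝ → ℝ) (k : ℕ) : ℝ := ∫ r in Ioc (0 : ℝ) 1, ψ r * cell ε k r

theorem donskerNoise_eq_noise {Ω : Type*} {d : ℕ} (η : Fin d → ℕ → Ω → ℝ) (ω : Ω) (i : Fin d)
    {r : ℝ} (hε : 0 < ε) (hr : 0 ≤ r) :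
    donskerNoise η ε ω i r = noise ε (fun k => η i k ω) r := by
  have h0 : 0 ≤ r / ε ^ 2 := by positivity
  unfold donskerNoise noise
  rw [tsum_eq_single ⌊r / ε ^ 2⌋₊]
  · have : r / ε ^ 2 ∈ Ico ((⌊r / ε ^ 2⌋₊ : ℕ) : ℝ) (⌊r / ε ^ 2⌋₊ + 1) :=
      ⟨Nat.floor_le h0, Nat.lt_floor_add_one _⟩
    rw [indicator_of_mem this]
    simp
  · intro k hk
    have : r / ε ^ 2 ∉ Ico (k : ℝ) (k + 1) := fun h => hk ((Nat.floor_eq_iff h0).2 h).symm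
    rw [indicator_of_notMem this, mul_zero]

theorem floor_div_lt_cellCount (hε : 0 < ε) {r : ℝ} (hr : r ≤ 1) :
    ⌊r / ε ^ 2⌋₊ < cellCount ε :=
  Nat.lt_succ_of_le (Nat.floor_mono (by gcongr))

theorem noise_eq_sum (hε : 0 < ε) {r : ℝ} (hr : r ≤ 1) :
    noise ε z r = ∑ k ∈ Finset.range (cellCount ε), z k * cell ε k r := by
  simp only [cell, noise]
  rw [Finset.sum_eq_single_of_mem ⌊r / ε ^ 2⌋₊
    (Finset.mem_range.2 (floor_div_lt_cellCount hε hr)) fun k _ hk => by simp [hk.symm]]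
  simp [mul_comm]

theorem measurable_cell (k : ℕ) : Measurable (cell ε k) :=
  Measurable.ite ((Nat.measurable_floor.comp (measurable_id.div_const _))
    (measurableSet_singleton k)) measurable_const measurable_const

theorem abs_cell_le (hε : 0 < ε) (k : ℕ) (r : ℝ) : |cell ε k r| ≤ 1 / ε := by
  unfold cell
  split_ifs
  · exact (abs_of_pos (by positivity)).le
  · simp; positivity

theorem measurable_noise : Measurable (noise ε z) :=
  ((measurable_from_nat (f := z)).comp
    (Nat.measurable_floor.comp (measurable_id.div_const _))).const_mul _

/-- A bound for the noise on `[0,1]`. -/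
def noiseBound (ε : ℝ) (z : ℕ → ℝ) : ℝ := ∑ k ∈ Finset.range (cellCount ε), |z k| * (1 / ε)

theorem noiseBound_nonneg (hε : 0 < ε) : 0 ≤ noiseBound ε z :=
  Finset.sum_nonneg fun _ _ => by positivity

theorem abs_noise_le (hε : 0 < ε) {r : ℝ} (hr : r ≤ 1) : |noise ε z r| ≤ noiseBound ε z := by
  rw [noise_eq_sum hε hr]
  refine (Finset.abs_sum_le_sum_abs _ _).trans (Finset.sum_le_sum fun k _ => ?_)
  rw [abs_mul]
  exact mul_le_mul_of_nonneg_left (abs_cell_le hε k r) (abs_nonneg _)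

theorem measurable_kernelDeriv : Measurable fun p : ℝ × ℝ => kernelDeriv H ε p.1 p.2 :=
  Measurable.ite (measurableSet_lt measurable_snd measurable_fst) (by fun_prop) measurable_const

theorem abs_kernelDeriv_le (hH : H < 1 / 2) (hε : 0 < ε) (u r : ℝ) :
    |kernelDeriv H ε u r| ≤ |H - 1 / 2| * ε ^ (H - 3 / 2) := by
  unfold kernelDeriv
  split_ifs with h
  · rw [abs_mul, abs_of_nonneg (Real.rpow_nonneg (by linarith) _)]
    exact mul_le_mul_of_nonneg_left
      (Real.rpow_le_rpow_of_nonpos hε (by linarith) (by linarith)) (abs_nonneg _)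
  · rw [abs_zero]; positivity

theorem integrableOn_of_abs_le {f : ℝ → ℝ} (hf : Measurable f)
    (hC : ∀ r ∈ Ioc (0 : ℝ) 1, |f r| ≤ C) : IntegrableOn f (Ioc 0 1) :=
  IntegrableOn.of_bound (by simp) hf.aestronglyMeasurable C
    ((ae_restrict_iff' measurableSet_Ioc).2 (ae_of_all _ hC))

theorem abs_setIntegral_Ioc_le {f : ℝ → ℝ} (hC : ∀ r ∈ Ioc (0 : ℝ) 1, |f r| ≤ C) :
    |∫ r in Ioc (0 : ℝ) 1, f r| ≤ C := by
  have h : ∀ r ∈ Ioc (0 : ℝ) 1, ‖f r‖ ≤ C := hC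
  simpa using norm_setIntegral_le_of_norm_le_const (μ := volume) (by simp) h

theorem measurable_velocity : Measurable (velocity H ε z) := by
  refine (measurable_noise.const_mul _).add ?_
  have h : StronglyMeasurable fun p : ℝ × ℝ => kernelDeriv H ε p.1 p.2 * noise ε z p.2 :=
    (measurable_kernelDeriv.mul (measurable_noise.comp measurable_snd)).stronglyMeasurable
  exact (h.integral_prod_right (ν := volume.restrict (Ioc (0 : ℝ) 1))).measurable

theorem measurable_adjointWeight (hg : Measurable g) : Measurable (adjointWeight H ε g) := by
  refine (hg.const_mul _).add ?_
  have h : StronglyMeasurable fun p : ℝ × ℝ => g p.1 * kernelDeriv H ε p.1 p.2 :=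
    ((hg.comp measurable_fst).mul measurable_kernelDeriv).stronglyMeasurable
  exact (h.integral_prod_left' (μ := volume.restrict (Ioc (0 : ℝ) 1))).measurable

theorem abs_velocity_le (hH : H < 1 / 2) (hε : 0 < ε) {u : ℝ} (hu : u ≤ 1) :
    |velocity H ε z u| ≤ ε ^ (H - 1 / 2) * noiseBound ε z +
      |H - 1 / 2| * ε ^ (H - 3 / 2) * noiseBound ε z := by
  refine (abs_add_le _ _).trans (add_le_add ?_ (abs_setIntegral_Ioc_le fun r hr => ?_))
  · rw [abs_mul, abs_of_nonneg (by positivity)]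
    gcongr
    exact abs_noise_le hε hu
  · rw [abs_mul]
    exact mul_le_mul (abs_kernelDeriv_le hH hε u r) (abs_noise_le hε hr.2) (abs_nonneg _)
      (by positivity)

theorem abs_adjointWeight_le (hH : H < 1 / 2) (hε : 0 < ε) (hg : ∀ r, |g r| ≤ C) (r : ℝ) :
    |adjointWeight H ε g r| ≤ ε ^ (H - 1 / 2) * C + C * (|H - 1 / 2| * ε ^ (H - 3 / 2)) := by
  have hC : 0 ≤ C := (abs_nonneg _).trans (hg 0)
  refine (abs_add_le _ _).trans (add_le_add ?_ (abs_setIntegral_Ioc_le fun u hu => ?_))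
  · rw [abs_mul, abs_of_nonneg (by positivity)]
    gcongr
    exact hg r
  · rw [abs_mul]
    exact mul_le_mul (hg u) (abs_kernelDeriv_le hH hε u r) (abs_nonneg _) hC

/-- Fubini: integrating `g` against the velocity is integrating its dual kernel against the
noise. -/
theorem integral_mul_velocity (hH : H < 1 / 2) (hε : 0 < ε) (hg : Measurable g)
    (hC : ∀ r, |g r| ≤ C) :
    ∫ u in Ioc (0 : ℝ) 1, g u * velocity H ε z u =
      ∫ r in Ioc (0 : ℝ) 1, adjointWeight H ε g r * noise ε z r := by
  have hC0 : 0 ≤ C := (abs_nonneg _).trans (hC 0)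
  set m := volume.restrict (Ioc (0 : ℝ) 1) with hm
  have hint : Integrable (fun p : ℝ × ℝ => g p.1 * (kernelDeriv H ε p.1 p.2 * noise ε z p.2))
      (m.prod m) := by
    have hmeas : Measurable
        (fun p : ℝ × ℝ => g p.1 * (kernelDeriv H ε p.1 p.2 * noise ε z p.2)) :=
      (hg.comp measurable_fst).mul (measurable_kernelDeriv.mul (measurable_noise.comp measurable_snd))
    refine Integrable.of_bound hmeas.aestronglyMeasurable
      (C * (|H - 1 / 2| * ε ^ (H - 3 / 2) * noiseBound ε z)) ?_
    rw [hm, Measure.prod_restrict]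
    refine (ae_restrict_iff' (measurableSet_Ioc.prod measurableSet_Ioc)).2
      (ae_of_all _ fun p hp => ?_)
    rw [Real.norm_eq_abs, abs_mul, abs_mul]
    refine mul_le_mul (hC _) (mul_le_mul (abs_kernelDeriv_le hH hε _ _)
      (abs_noise_le hε hp.2.2) (abs_nonneg _) (by positivity)) (by positivity) hC0
  have hgn : Integrable (fun u => g u * noise ε z u) m :=
    integrableOn_of_abs_le (C := C * noiseBound ε z) (hg.mul measurable_noise) fun r hr => by
      rw [abs_mul]
      exact mul_le_mul (hC r) (abs_noise_le hε hr.2) (abs_nonneg _) hC0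
  have h1 : ∀ u, g u * velocity H ε z u = ε ^ (H - 1 / 2) * (g u * noise ε z u) +
      ∫ r, g u * (kernelDeriv H ε u r * noise ε z r) ∂m := fun u => by
    rw [integral_const_mul, velocity]; ring
  have h2 : ∀ r, adjointWeight H ε g r * noise ε z r = ε ^ (H - 1 / 2) * (g r * noise ε z r) +
      ∫ u, g u * (kernelDeriv H ε u r * noise ε z r) ∂m := fun r => by
    simp_rw [← mul_assoc]
    rw [integral_mul_const, adjointWeight]; ring
  simp_rw [h1, h2]
  rw [integral_add (hgn.const_mul _) hint.integral_prod_left,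
    integral_add (hgn.const_mul _) hint.integral_prod_right, integral_integral_swap hint]

/-- The integral against the noise is a finite linear combination of the driving sequence. -/
theorem integral_mul_noise (hε : 0 < ε) (hψ : Measurable ψ) (hC : ∀ r ∈ Ioc (0 : ℝ) 1, |ψ r| ≤ C) :
    ∫ r in Ioc (0 : ℝ) 1, ψ r * noise ε z r =
      ∑ k ∈ Finset.range (cellCount ε), z k * cellCoeff ε ψ k := by
  have hC0 : 0 ≤ C := (abs_nonneg _).trans (hC 1 (by simp))
  have h1 : ∫ r in Ioc (0 : ℝ) 1, ψ r * noise ε z r = ∫ r in Ioc (0 : ℝ) 1,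
      ∑ k ∈ Finset.range (cellCount ε), z k * (ψ r * cell ε k r) :=
    setIntegral_congr_fun measurableSet_Ioc fun r hr => by
      simp only [noise_eq_sum hε hr.2, Finset.mul_sum]
      exact Finset.sum_congr rfl fun k _ => by ring
  rw [h1, integral_finsetSum]
  · simp_rw [integral_const_mul]; rfl
  · intro k _
    refine Integrable.const_mul (integrableOn_of_abs_le (C := C * (1 / ε))
      (hψ.mul (measurable_cell k)) fun r hr => ?_) _
    rw [Pi.mul_apply, abs_mul]
    exact mul_le_mul (hC r hr) (abs_cell_le hε k r) (abs_nonneg _) hC0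

theorem integral_cell_sq_le (hε : 0 < ε) (k : ℕ) :
    ∫ r in Ioc (0 : ℝ) 1, cell ε k r * cell ε k r ≤ 1 := by
  have h1 : ∀ r ∈ Ioc (0 : ℝ) 1, cell ε k r * cell ε k r ≤
      (Ico (k * ε ^ 2) ((k + 1) * ε ^ 2)).indicator (fun _ => (1 / ε) ^ 2) r := by
    intro r hr
    unfold cell
    split_ifs with h
    · have h2 := (Nat.floor_eq_iff (show 0 ≤ r / ε ^ 2 by have := hr.1; positivity)).1 h
      rw [le_div_iff₀ (by positivity), div_lt_iff₀ (by positivity)] at h2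
      rw [indicator_of_mem (show r ∈ Ico _ _ from h2), sq]
    · rw [mul_zero]
      exact indicator_nonneg (fun _ _ => by positivity) r
  have hi : Integrable ((Ico (k * ε ^ 2) ((k + 1) * ε ^ 2)).indicator
      (fun _ => (1 / ε) ^ 2)) volume :=
    (integrable_indicator_iff measurableSet_Ico).2 (by simp)
  calc ∫ r in Ioc (0 : ℝ) 1, cell ε k r * cell ε k r
      ≤ ∫ r in Ioc (0 : ℝ) 1,
        (Ico (k * ε ^ 2) ((k + 1) * ε ^ 2)).indicator (fun _ => (1 / ε) ^ 2) r := by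
        refine setIntegral_mono_on ?_ hi.integrableOn measurableSet_Ioc h1
        refine integrableOn_of_abs_le (C := 1 / ε * (1 / ε))
          ((measurable_cell k).mul (measurable_cell k)) fun r _ => ?_
        rw [abs_mul]
        exact mul_le_mul (abs_cell_le hε k r) (abs_cell_le hε k r) (abs_nonneg _) (by positivity)
    _ ≤ ∫ r, (Ico (k * ε ^ 2) ((k + 1) * ε ^ 2)).indicator (fun _ => (1 / ε) ^ 2) r :=
        setIntegral_le_integral hi (ae_of_all _ fun r => indicator_nonneg
          (fun _ _ => by positivity) r)
    _ = 1 := by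
        rw [integral_indicator_const _ measurableSet_Ico, Real.volume_real_Ico_of_le (by gcongr; simp)]
        have : ε ^ 2 ≠ 0 := by positivity
        simp only [add_mul, one_mul, add_sub_cancel_left, smul_eq_mul]
        field_simp

/-- Bessel's inequality for the (sub-orthonormal) system of cells. -/
theorem sum_cellCoeff_sq_le (hε : 0 < ε) (hψ : Measurable ψ)
    (hC : ∀ r ∈ Ioc (0 : ℝ) 1, |ψ r| ≤ C) :
    ∑ k ∈ Finset.range (cellCount ε), cellCoeff ε ψ k ^ 2 ≤ ∫ r in Ioc (0 : ℝ) 1, ψ r ^ 2 := by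
  have hC0 : 0 ≤ C := (abs_nonneg _).trans (hC 1 (by simp))
  set b := cellCoeff ε ψ with hb
  set n := noise ε b with hn
  have hn_meas : Measurable n := measurable_noise
  have hn_le : ∀ r ∈ Ioc (0 : ℝ) 1, |n r| ≤ noiseBound ε b := fun r hr => abs_noise_le hε hr.2
  have hN := noiseBound_nonneg (z := b) hε
  have hψn : ∫ r in Ioc (0 : ℝ) 1, ψ r * n r = ∑ k ∈ Finset.range (cellCount ε), b k ^ 2 := by
    rw [hn, integral_mul_noise hε hψ hC]
    exact Finset.sum_congr rfl fun k _ => (sq _).symm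
  have hnn : ∫ r in Ioc (0 : ℝ) 1, n r * n r ≤ ∑ k ∈ Finset.range (cellCount ε), b k ^ 2 := by
    rw [hn, integral_mul_noise hε hn_meas hn_le]
    refine Finset.sum_le_sum fun k hk => ?_
    have h1 : cellCoeff ε n k = b k * ∫ r in Ioc (0 : ℝ) 1, cell ε k r * cell ε k r := by
      rw [cellCoeff, ← integral_const_mul]
      congr 1
      ext r
      simp only [hn, noise, cell]
      split_ifs with h
      · rw [h]; ring
      · ring
    rw [h1, ← mul_assoc, sq]
    exact mul_le_of_le_one_right (mul_self_nonneg _) (integral_cell_sq_le hε k)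
  have hi1 : IntegrableOn (fun r => ψ r ^ 2) (Ioc 0 1) :=
    integrableOn_of_abs_le (C := C ^ 2) (hψ.pow_const 2) fun r hr => by
      rw [abs_pow]; exact pow_le_pow_left₀ (abs_nonneg _) (hC r hr) 2
  have hi2 : IntegrableOn (fun r => ψ r * n r) (Ioc 0 1) :=
    integrableOn_of_abs_le (C := C * noiseBound ε b) (hψ.mul hn_meas) fun r hr => by
      rw [abs_mul]; exact mul_le_mul (hC r hr) (hn_le r hr) (abs_nonneg _) hC0
  have hi3 : IntegrableOn (fun r => n r * n r) (Ioc 0 1) :=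
    integrableOn_of_abs_le (C := noiseBound ε b * noiseBound ε b) (hn_meas.mul hn_meas)
      fun r hr => by
        rw [abs_mul]; exact mul_le_mul (hn_le r hr) (hn_le r hr) (abs_nonneg _) hN
  -- expand `0 ≤ ∫ (ψ - n)²`, where `n` is the noise driven by the coefficients of `ψ` itself
  have h0 : 0 ≤ ∫ r in Ioc (0 : ℝ) 1, (ψ r ^ 2 - 2 * (ψ r * n r) + n r * n r) :=
    integral_nonneg fun r => by
      have := sq_nonneg (ψ r - n r)
      simp only [Pi.zero_apply]
      nlinarith
  have hi12 : IntegrableOn (fun r => ψ r ^ 2 - 2 * (ψ r * n r)) (Ioc 0 1) :=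
    hi1.sub (hi2.const_mul 2)
  rw [integral_add hi12 hi3, integral_sub hi1 (hi2.const_mul 2),
    integral_const_mul, hψn] at h0
  linarith

end Kernel

/-! ### The path is the primitive of its velocity -/

section Weight

variable {H ε s t : ℝ} {z : ℕ → ℝ} {f : ℝ → ℝ}

theorem adjointWeight_indicator (hs : 0 ≤ s) (ht : t ≤ 1) (r : ℝ) :
    adjointWeight H ε ((Ioc s t).indicator f) r =
      ε ^ (H - 1 / 2) * (Ioc s t).indicator f r +
        ∫ u in Ioc (max s r) t, f u * ((H - 1 / 2) * (u + ε - r) ^ (H - 3 / 2)) := by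
  have hsub : Ioc (max s r) t ⊆ Ioc 0 1 := fun u hu =>
    ⟨hs.trans_lt ((le_max_left _ _).trans_lt hu.1), hu.2.trans ht⟩
  rw [adjointWeight, ← inter_eq_self_of_subset_right hsub, ← setIntegral_indicator measurableSet_Ioc]
  congr 2
  ext u
  simp only [kernelDeriv, indicator, mem_Ioc, max_lt_iff]
  by_cases h1 : s < u <;> by_cases h2 : r < u <;> by_cases h3 : u ≤ t <;> simp [h1, h2, h3]

theorem integral_kernelDeriv {p q r : ℝ} (hpq : p ≤ q) (hp : 0 < p + ε - r) :
    ∫ u in p..q, (H - 1 / 2) * (u + ε - r) ^ (H - 3 / 2) =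
      (q + ε - r) ^ (H - 1 / 2) - (p + ε - r) ^ (H - 1 / 2) := by
  have hpos : ∀ u ∈ uIcc p q, 0 < u + ε - r := fun u hu => by
    rw [uIcc_of_le hpq] at hu; linarith [hu.1]
  refine intervalIntegral.integral_eq_sub_of_hasDerivAt
    (f := fun u => (u + ε - r) ^ (H - 1 / 2)) (fun u hu => ?_) ?_
  · have h1 : HasDerivAt (fun u : ℝ => u + ε - r) 1 u := ((hasDerivAt_id u).add_const ε).sub_const r
    have h2 := h1.rpow_const (p := H - 1 / 2) (Or.inl (hpos u hu).ne')
    rwa [one_mul, show H - 1 / 2 - 1 = H - 3 / 2 by ring] at h2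
  · refine ContinuousOn.intervalIntegrable fun u hu => ContinuousAt.continuousWithinAt ?_
    exact continuousAt_const.mul ((by fun_prop : ContinuousAt (fun u : ℝ => u + ε - r) u).rpow_const
      (Or.inl (hpos u hu).ne'))

theorem continuousOn_kernel {p q r : ℝ} (hp : 0 < p + ε - r) (b : ℝ) :
    ContinuousOn (fun u => (u + ε - r) ^ b) (Icc p q) := fun u hu =>
  ((by fun_prop : ContinuousAt (fun u : ℝ => u + ε - r) u).rpow_const
    (Or.inl (by linarith [hu.1]))).continuousWithinAt

theorem measurable_indicator_of_continuousOn (hf : ContinuousOn f (Icc s t)) :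
    Measurable ((Ioc s t).indicator f) := by
  classical
  rw [← piecewise_eq_indicator]
  exact (hf.mono Ioc_subset_Icc_self).measurable_piecewise continuousOn_const measurableSet_Ioc

theorem setIntegral_indicator_mul_velocity (hs : 0 ≤ s) (hst : s ≤ t) (ht : t ≤ 1) :
    ∫ u in Ioc (0 : ℝ) 1, (Ioc s t).indicator f u * velocity H ε z u =
      ∫ u in s..t, f u * velocity H ε z u := by
  simp_rw [← indicator_mul_left]
  rw [setIntegral_indicator measurableSet_Ioc, intervalIntegral.integral_of_le hst,
    inter_eq_self_of_subset_right (Ioc_subset_Ioc hs ht)]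

theorem adjointWeight_one (hε : 0 < ε) (ht : t ≤ 1) {r : ℝ} (hr : 0 < r) :
    adjointWeight H ε ((Ioc 0 t).indicator fun _ => 1) r =
      (Ioc 0 t).indicator (fun r => (t + ε - r) ^ (H - 1 / 2)) r := by
  rw [adjointWeight_indicator le_rfl ht, max_eq_right hr.le]
  simp_rw [one_mul]
  by_cases h : r ≤ t
  · rw [← intervalIntegral.integral_of_le h, integral_kernelDeriv h (by linarith),
      indicator_of_mem (show r ∈ Ioc 0 t from ⟨hr, h⟩),
      indicator_of_mem (show r ∈ Ioc 0 t from ⟨hr, h⟩), add_sub_cancel_left]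
    ring
  · rw [indicator_of_notMem (fun h' => h h'.2), indicator_of_notMem (fun h' => h h'.2),
      Ioc_eq_empty (fun h' => h h'.le)]
    simp

theorem donskerPath_eq_integral_velocity {Ω : Type*} {d : ℕ} (η : Fin d → ℕ → Ω → ℝ) (ω : Ω)
    (i : Fin d) (hH : H < 1 / 2) (hε : 0 < ε) (t : I) :
    donskerPath H η ε ω i t = ∫ u in (0 : ℝ)..t, velocity H ε (fun k => η i k ω) u := by
  have h1 := setIntegral_indicator_mul_velocity (H := H) (ε := ε) (z := fun k => η i k ω)
    (f := fun _ => 1) le_rfl t.2.1 t.2.2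
  simp_rw [one_mul] at h1
  rw [← h1, integral_mul_velocity (C := 1) hH hε (measurable_const.indicator measurableSet_Ioc),
    donskerPath, intervalIntegral.integral_of_le t.2.1,
    ← inter_eq_self_of_subset_right (Ioc_subset_Ioc le_rfl t.2.2 : Ioc (0 : ℝ) t ⊆ Ioc 0 1),
    ← setIntegral_indicator measurableSet_Ioc]
  · refine setIntegral_congr_fun measurableSet_Ioc fun r hr => ?_
    simp only [inter_eq_self_of_subset_right (Ioc_subset_Ioc le_rfl t.2.2 : Ioc (0 : ℝ) t ⊆ Ioc 0 1)]
    rw [adjointWeight_one hε t.2.2 hr.1, ← donskerNoise_eq_noise η ω i hε hr.1.le,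
      ← indicator_mul_left]
  · intro r
    by_cases h : r ∈ Ioc 0 (t : ℝ) <;> simp [h]

/-! ### The variance of an integral against the path -/

theorem integral_sub_rpow (hH : 0 < H) {p q c : ℝ} :
    ∫ r in p..q, (c - r) ^ (2 * H - 1) =
      ((c - p) ^ (2 * H) - (c - q) ^ (2 * H)) / (2 * H) := by
  rw [intervalIntegral.integral_comp_sub_left (fun x : ℝ => x ^ (2 * H - 1)),
    integral_rpow (Or.inl (by linarith)), sub_add_cancel]

/-- The dual kernel of `1_{(s,t]} f` inside the interval. The derivative of the kernel is not
integrable at the diagonal uniformly in `ε`; replacing `f u` by `f u - f r` compensates for this,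
and the part with `f r` integrates to the kernel itself, cancelling the diagonal term. -/
theorem abs_adjointWeight_le_of_mem {F M β : ℝ} (hH : H < 1 / 2) (hε : 0 < ε)
    (hβ0 : 0 < β) (hβ : 0 < β + (H - 1 / 2))
    (hs : 0 ≤ s) (ht : t ≤ 1) (hf : ContinuousOn f (Icc s t)) (hM : 0 ≤ M)
    (hfF : ∀ u ∈ Icc s t, |f u| ≤ F)
    (hfM : ∀ r ∈ Icc s t, ∀ u ∈ Icc s t, r ≤ u → |f u - f r| ≤ M * (u - r) ^ β)
    {r : ℝ} (hr : r ∈ Ioo s t) :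
    |adjointWeight H ε ((Ioc s t).indicator f) r| ≤
      (F + M * (t - s) ^ β * (|H - 1 / 2| / (β + (H - 1 / 2)))) * (t - r) ^ (H - 1 / 2) := by
  have hrt : 0 < t - r := by linarith [hr.2]
  have hrI : r ∈ Icc s t := ⟨hr.1.le, hr.2.le⟩
  have hsubI : Icc r t ⊆ Icc s t := Icc_subset_Icc hr.1.le le_rfl
  have hF : 0 ≤ F := (abs_nonneg _).trans (hfF r hrI)
  have hk : ContinuousOn (fun u => (H - 1 / 2) * (u + ε - r) ^ (H - 3 / 2)) (Icc r t) :=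
    continuousOn_const.mul (continuousOn_kernel (by linarith) _)
  have hfr : ContinuousOn f (Icc r t) := hf.mono hsubI
  have hi1 : IntervalIntegrable (fun u => f r * ((H - 1 / 2) * (u + ε - r) ^ (H - 3 / 2)))
      volume r t := by
    refine ContinuousOn.intervalIntegrable ?_
    rw [uIcc_of_le hr.2.le]
    exact continuousOn_const.mul hk
  have hi2 : IntervalIntegrable
      (fun u => (f u - f r) * ((H - 1 / 2) * (u + ε - r) ^ (H - 3 / 2))) volume r t := by
    refine ContinuousOn.intervalIntegrable ?_
    rw [uIcc_of_le hr.2.le]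
    exact (hfr.sub continuousOn_const).mul hk
  have key : adjointWeight H ε ((Ioc s t).indicator f) r = f r * (t + ε - r) ^ (H - 1 / 2) +
      ∫ u in r..t, (f u - f r) * ((H - 1 / 2) * (u + ε - r) ^ (H - 3 / 2)) := by
    rw [adjointWeight_indicator hs ht, max_eq_right hr.1.le,
      indicator_of_mem (show r ∈ Ioc s t from ⟨hr.1, hr.2.le⟩),
      ← intervalIntegral.integral_of_le hr.2.le]
    have h1 : ∀ u, f u * ((H - 1 / 2) * (u + ε - r) ^ (H - 3 / 2)) =
        f r * ((H - 1 / 2) * (u + ε - r) ^ (H - 3 / 2)) +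
          (f u - f r) * ((H - 1 / 2) * (u + ε - r) ^ (H - 3 / 2)) := fun u => by ring
    simp_rw [h1]
    rw [intervalIntegral.integral_add hi1 hi2, intervalIntegral.integral_const_mul,
      integral_kernelDeriv hr.2.le (by linarith), add_sub_cancel_left]
    ring
  rw [key]
  have h1 : |f r * (t + ε - r) ^ (H - 1 / 2)| ≤ F * (t - r) ^ (H - 1 / 2) := by
    rw [abs_mul, abs_of_nonneg (Real.rpow_nonneg (by linarith) _)]
    exact mul_le_mul (hfF r hrI)
      (Real.rpow_le_rpow_of_nonpos hrt (by linarith) (by linarith))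
      (Real.rpow_nonneg (by linarith) _) hF
  have h2 : ‖∫ u in r..t, (f u - f r) * ((H - 1 / 2) * (u + ε - r) ^ (H - 3 / 2))‖ ≤
      ∫ u in r..t, M * |H - 1 / 2| * (u - r) ^ (β + (H - 3 / 2)) := by
    refine intervalIntegral.norm_integral_le_of_norm_le hr.2.le (ae_of_all _ fun u hu => ?_) ?_
    · have hur : 0 < u - r := by linarith [hu.1]
      rw [Real.norm_eq_abs, abs_mul, abs_mul, abs_of_nonneg (Real.rpow_nonneg (by linarith) _),
        Real.rpow_add hur]
      calc |f u - f r| * (|H - 1 / 2| * (u + ε - r) ^ (H - 3 / 2))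
          ≤ M * (u - r) ^ β * (|H - 1 / 2| * (u - r) ^ (H - 3 / 2)) := by
            refine mul_le_mul (hfM r hrI u (hsubI ⟨hu.1.le, hu.2⟩) hu.1.le)
              (mul_le_mul_of_nonneg_left (Real.rpow_le_rpow_of_nonpos hur (by linarith)
                (by linarith)) (abs_nonneg _)) ?_ (by positivity)
            exact mul_nonneg (abs_nonneg _) (Real.rpow_nonneg (by linarith) _)
        _ = _ := by ring
    · refine IntervalIntegrable.const_mul ?_ _
      have := (intervalIntegral.intervalIntegrable_rpow' (a := r - r) (b := t - r)
        (show -1 < β + (H - 3 / 2) by linarith)).comp_sub_right r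
      simpa using this
  have h3 : ∫ u in r..t, M * |H - 1 / 2| * (u - r) ^ (β + (H - 3 / 2)) =
      M * |H - 1 / 2| * ((t - r) ^ (β + (H - 1 / 2)) / (β + (H - 1 / 2))) := by
    rw [intervalIntegral.integral_const_mul,
      intervalIntegral.integral_comp_sub_right (fun x : ℝ => x ^ (β + (H - 3 / 2))),
      integral_rpow (Or.inl (by linarith)), sub_self,
      show β + (H - 3 / 2) + 1 = β + (H - 1 / 2) by ring, Real.zero_rpow hβ.ne', sub_zero]
  have h4 : (t - r) ^ (β + (H - 1 / 2)) ≤ (t - s) ^ β * (t - r) ^ (H - 1 / 2) := by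
    rw [Real.rpow_add hrt]
    exact mul_le_mul_of_nonneg_right
      (Real.rpow_le_rpow hrt.le (by linarith [hr.1]) hβ0.le) (by positivity)
  rw [h3] at h2
  calc _ ≤ F * (t - r) ^ (H - 1 / 2) +
        M * |H - 1 / 2| * ((t - r) ^ (β + (H - 1 / 2)) / (β + (H - 1 / 2))) :=
        (abs_add_le _ _).trans (add_le_add h1 h2)
    _ ≤ F * (t - r) ^ (H - 1 / 2) +
        M * |H - 1 / 2| * ((t - s) ^ β * (t - r) ^ (H - 1 / 2) / (β + (H - 1 / 2))) := by gcongr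
    _ = _ := by ring

/-- The dual kernel of `1_{(s,t]} f` before the interval. -/
theorem abs_adjointWeight_le_of_le {F : ℝ} (hH : H < 1 / 2) (hε : 0 < ε)
    (hs : 0 ≤ s) (hst : s ≤ t) (ht : t ≤ 1) (hfF : ∀ u ∈ Icc s t, |f u| ≤ F)
    {r : ℝ} (hr : r ≤ s) :
    |adjointWeight H ε ((Ioc s t).indicator f) r| ≤
      F * ((s + ε - r) ^ (H - 1 / 2) - (t + ε - r) ^ (H - 1 / 2)) := by
  have hF : 0 ≤ F := (abs_nonneg _).trans (hfF s ⟨le_rfl, hst⟩)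
  rw [adjointWeight_indicator hs ht, max_eq_left hr, indicator_of_notMem (fun h => by
    linarith [h.1]), mul_zero, zero_add, ← intervalIntegral.integral_of_le hst,
    ← neg_sub ((t + ε - r) ^ (H - 1 / 2)), ← integral_kernelDeriv hst (by linarith),
    ← intervalIntegral.integral_neg,
    ← intervalIntegral.integral_const_mul, ← Real.norm_eq_abs]
  refine intervalIntegral.norm_integral_le_of_norm_le hst (ae_of_all _ fun u hu => ?_) ?_
  · have hk : 0 ≤ (u + ε - r) ^ (H - 3 / 2) := Real.rpow_nonneg (by linarith [hu.1]) _
    rw [Real.norm_eq_abs, abs_mul, abs_mul, abs_of_nonneg hk,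
      abs_of_neg (show H - 1 / 2 < 0 by linarith), ← neg_mul]
    exact mul_le_mul_of_nonneg_right (hfF u ⟨hu.1.le, hu.2⟩) (mul_nonneg (by linarith) hk)
  · refine ContinuousOn.intervalIntegrable ?_
    rw [uIcc_of_le hst]
    exact continuousOn_const.mul
      (continuousOn_const.mul (continuousOn_kernel (by linarith) _)).neg

theorem adjointWeight_eq_zero (hs : 0 ≤ s) (ht : t ≤ 1) {r : ℝ} (hr : t < r) :
    adjointWeight H ε ((Ioc s t).indicator f) r = 0 := by
  rw [adjointWeight_indicator hs ht, indicator_of_notMem (fun h => by linarith [h.2]),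
    Ioc_eq_empty (fun h => by linarith [le_max_right s r])]
  simp

/-- The energy of the dual kernel of `1_{(s,t]} f`, uniformly in `ε`. The past of `s` and the
interval `(s,t]` contribute one half of the bound each. -/
theorem integral_adjointWeight_sq_le {F M β : ℝ} (hH0 : 0 < H) (hH : H < 1 / 2) (hε : 0 < ε)
    (hβ0 : 0 < β) (hβ : 0 < β + (H - 1 / 2))
    (hs : 0 ≤ s) (hst : s ≤ t) (ht : t ≤ 1) (hf : ContinuousOn f (Icc s t)) (hM : 0 ≤ M)
    (hfF : ∀ u ∈ Icc s t, |f u| ≤ F)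
    (hfM : ∀ r ∈ Icc s t, ∀ u ∈ Icc s t, r ≤ u → |f u - f r| ≤ M * (u - r) ^ β) :
    ∫ r in Ioc (0 : ℝ) 1, adjointWeight H ε ((Ioc s t).indicator f) r ^ 2 ≤
      (F + M * (t - s) ^ β * (|H - 1 / 2| / (β + (H - 1 / 2)))) ^ 2 * ((t - s) ^ (2 * H) / H) := by
  set ψ := adjointWeight H ε ((Ioc s t).indicator f) with hψ
  set B := F + M * (t - s) ^ β * (|H - 1 / 2| / (β + (H - 1 / 2))) with hB
  have hF : 0 ≤ F := (abs_nonneg _).trans (hfF s ⟨le_rfl, hst⟩)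
  have hts : 0 ≤ t - s := sub_nonneg.2 hst
  have hFB : F ≤ B := le_add_of_nonneg_right (by positivity)
  have hB0 : 0 ≤ B := hF.trans hFB
  have hg : ∀ r, |(Ioc s t).indicator f r| ≤ F := fun r => by
    by_cases h : r ∈ Ioc s t
    · rw [indicator_of_mem h]; exact hfF r ⟨h.1.le, h.2⟩
    · rw [indicator_of_notMem h, abs_zero]; exact hF
  have hψm : Measurable ψ := measurable_adjointWeight (measurable_indicator_of_continuousOn hf)
  have hi : IntegrableOn (fun r => ψ r ^ 2) (Ioc 0 1) :=
    integrableOn_of_abs_le (hψm.pow_const 2) fun r _ => by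
      rw [abs_pow]
      exact pow_le_pow_left₀ (abs_nonneg _) (abs_adjointWeight_le hH hε hg r) 2
  have hint : ∀ p q, 0 ≤ p → p ≤ q → q ≤ 1 → IntervalIntegrable (fun r => ψ r ^ 2) volume p q :=
    fun p q hp hpq hq => (intervalIntegrable_iff_integrableOn_Ioc_of_le hpq).2
      (hi.mono_set (Ioc_subset_Ioc hp hq))
  have hsplit : ∫ r in Ioc (0 : ℝ) 1, ψ r ^ 2 =
      (∫ r in (0 : ℝ)..s, ψ r ^ 2) + (∫ r in s..t, ψ r ^ 2) + ∫ r in t..1, ψ r ^ 2 := by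
    rw [← intervalIntegral.integral_of_le zero_le_one,
      intervalIntegral.integral_add_adjacent_intervals (hint 0 s le_rfl hs (hst.trans ht))
        (hint s t hs hst ht),
      intervalIntegral.integral_add_adjacent_intervals (hint 0 t le_rfl (hs.trans hst) ht)
        (hint t 1 (hs.trans hst) ht le_rfl)]
  have h3 : ∫ r in t..1, ψ r ^ 2 = 0 := by
    rw [intervalIntegral.integral_of_le ht]
    refine setIntegral_eq_zero_of_forall_eq_zero fun r hr => ?_
    rw [hψ, adjointWeight_eq_zero hs ht hr.1, sq, mul_zero]
  have h2 : ∫ r in s..t, ψ r ^ 2 ≤ B ^ 2 * ((t - s) ^ (2 * H) / (2 * H)) := by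
    have h : ∫ r in s..t, B ^ 2 * (t - r) ^ (2 * H - 1) =
        B ^ 2 * ((t - s) ^ (2 * H) / (2 * H)) := by
      rw [intervalIntegral.integral_const_mul, integral_sub_rpow hH0, sub_self,
        Real.zero_rpow (by positivity), sub_zero]
    rw [← h]
    refine intervalIntegral.integral_mono_on_of_le_Ioo hst (hint s t hs hst ht) ?_ fun r hr => ?_
    · refine IntervalIntegrable.const_mul ?_ _
      have := (intervalIntegral.intervalIntegrable_rpow' (a := t - s) (b := t - t)
        (show -1 < 2 * H - 1 by linarith)).comp_sub_left t
      simpa using this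
    · have h := abs_adjointWeight_le_of_mem hH hε hβ0 hβ hs ht hf hM hfF hfM hr
      have hp : ((t - r) ^ (H - 1 / 2)) ^ 2 = (t - r) ^ (2 * H - 1) := by
        rw [← Real.rpow_natCast, ← Real.rpow_mul (by linarith [hr.2])]
        congr 1; push_cast; ring
      rw [← sq_abs, ← hp, ← mul_pow]
      exact pow_le_pow_left₀ (abs_nonneg _) h 2
  have h1 : ∫ r in (0 : ℝ)..s, ψ r ^ 2 ≤ B ^ 2 * ((t - s) ^ (2 * H) / (2 * H)) := by
    have hkint : ∀ c, s < c → IntervalIntegrable (fun r => (c - r) ^ (2 * H - 1)) volume 0 s := by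
      intro c hc
      refine ContinuousOn.intervalIntegrable fun r hr => ContinuousAt.continuousWithinAt ?_
      rw [uIcc_of_le hs] at hr
      exact (by fun_prop : ContinuousAt (fun r : ℝ => c - r) r).rpow_const
        (Or.inl (by linarith [hr.2]))
    have h : ∫ r in (0 : ℝ)..s, B ^ 2 * ((s + ε - r) ^ (2 * H - 1) - (t + ε - r) ^ (2 * H - 1)) ≤
        B ^ 2 * ((t - s) ^ (2 * H) / (2 * H)) := by
      rw [intervalIntegral.integral_const_mul, intervalIntegral.integral_sub
        (hkint _ (by linarith)) (hkint _ (by linarith)), integral_sub_rpow hH0,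
        integral_sub_rpow hH0, ← sub_div]
      gcongr
      have e1 : (s + ε) ^ (2 * H) ≤ (t + ε) ^ (2 * H) :=
        Real.rpow_le_rpow (by linarith) (by linarith) (by linarith)
      have e2 : (t - s + ε) ^ (2 * H) ≤ (t - s) ^ (2 * H) + ε ^ (2 * H) :=
        Real.rpow_add_le_add_rpow hts hε.le (by linarith) (by linarith)
      rw [show s + ε - s = ε by ring, show t + ε - s = t - s + ε by ring, sub_zero, sub_zero]
      linarith
    refine le_trans ?_ h
    refine intervalIntegral.integral_mono_on hs (hint 0 s le_rfl hs (hst.trans ht))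
      (((hkint _ (by linarith)).sub (hkint _ (by linarith))).const_mul _) fun r hr => ?_
    have hb := abs_adjointWeight_le_of_le hH hε hs hst ht hfF hr.2
    set x := (s + ε - r) ^ (H - 1 / 2) with hx
    set y := (t + ε - r) ^ (H - 1 / 2) with hy
    have hy0 : 0 ≤ y := Real.rpow_nonneg (by linarith [hr.2]) _
    have hxy : y ≤ x := Real.rpow_le_rpow_of_nonpos (by linarith [hr.2]) (by linarith)
      (by linarith)
    have hx2 : x ^ 2 = (s + ε - r) ^ (2 * H - 1) := by
      rw [hx, ← Real.rpow_natCast, ← Real.rpow_mul (by linarith [hr.2])]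
      congr 1; push_cast; ring
    have hy2 : y ^ 2 = (t + ε - r) ^ (2 * H - 1) := by
      rw [hy, ← Real.rpow_natCast, ← Real.rpow_mul (by linarith [hr.2])]
      congr 1; push_cast; ring
    rw [← hx2, ← hy2, ← sq_abs]
    calc |ψ r| ^ 2 ≤ (F * (x - y)) ^ 2 := pow_le_pow_left₀ (abs_nonneg _) hb 2
      _ = F ^ 2 * (x - y) ^ 2 := mul_pow _ _ _
      -- `(x - y)² ≤ x² - y²` because `0 ≤ y ≤ x`
      _ ≤ B ^ 2 * (x ^ 2 - y ^ 2) := by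
        have : (x - y) ^ 2 ≤ x ^ 2 - y ^ 2 := by nlinarith
        gcongr
  rw [hsplit, h3, add_zero]
  calc _ ≤ B ^ 2 * ((t - s) ^ (2 * H) / (2 * H)) + B ^ 2 * ((t - s) ^ (2 * H) / (2 * H)) :=
        add_le_add h1 h2
    _ = _ := by field_simp; ring

end Weight

/-! ### Dyadic chaining -/

section Chaining

/-- The largest dyadic number of level `n` below `t`. -/
def dyadicFloor (n : ℕ) (t : ℝ) : ℝ := ⌊2 ^ n * t⌋₊ / 2 ^ n

theorem dyadicFloor_nonneg (n : ℕ) (t : ℝ) : 0 ≤ dyadicFloor n t := by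
  unfold dyadicFloor; positivity

theorem dyadicFloor_le {n : ℕ} {t : ℝ} (ht : 0 ≤ t) : dyadicFloor n t ≤ t := by
  rw [dyadicFloor, div_le_iff₀ (by positivity), mul_comm t]
  exact Nat.floor_le (by positivity)

theorem lt_dyadicFloor_add (n : ℕ) (t : ℝ) : t < dyadicFloor n t + (1 / 2) ^ n := by
  rw [dyadicFloor, one_div, inv_pow, ← one_div, ← add_div, lt_div_iff₀ (by positivity), mul_comm t]
  exact Nat.lt_floor_add_one _

theorem one_half_pow_rpow (n : ℕ) (γ : ℝ) : (((1 : ℝ) / 2) ^ n) ^ γ = ((1 / 2) ^ γ) ^ n := by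
  rw [← Real.rpow_natCast, ← Real.rpow_mul (by norm_num), mul_comm,
    Real.rpow_mul (by norm_num), Real.rpow_natCast]

variable {A : ℝ → ℝ → ℝ} {γ R L Λ : ℝ}

/-- An almost additive two-parameter function which is Lipschitz (with any constant) and is of
order `γ` on dyadic intervals is of order `γ` on all intervals ending at a time `t` and starting
at the dyadic floor of `t`. -/
theorem abs_dyadicFloor_le (hγ : 0 < γ) (hR : 0 ≤ R) (hL : 0 ≤ L)
    (hdyadic : ∀ n k : ℕ, k < 2 ^ n →
      |A (k / 2 ^ n) ((k + 1) / 2 ^ n)| ≤ R * ((1 / 2) ^ γ) ^ n)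
    (hadd : ∀ s u t, 0 ≤ s → s ≤ u → u ≤ t → t ≤ 1 →
      |A s t - A s u - A u t| ≤ L * (t - s) ^ γ)
    (hlip : ∀ s t, 0 ≤ s → s ≤ t → t ≤ 1 → |A s t| ≤ Λ * (t - s))
    (n : ℕ) {t : ℝ} (ht0 : 0 ≤ t) (ht : t ≤ 1) :
    |A (dyadicFloor n t) t| ≤ (R + L) / (1 - (1 / 2) ^ γ) * ((1 / 2) ^ γ) ^ n := by
  set q : ℝ := (1 / 2) ^ γ with hq
  have hq0 : 0 < q := by positivity
  have hq1 : q < 1 := Real.rpow_lt_one (by norm_num) (by norm_num) hγ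
  -- one refinement step: the floor moves by at most one interval of the next level
  have hstep : ∀ n, |A (dyadicFloor n t) t| ≤
      (R + L) * q ^ n + |A (dyadicFloor (n + 1) t) t| := by
    intro n
    set m := ⌊2 ^ n * t⌋₊ with hm
    set m' := ⌊2 ^ (n + 1) * t⌋₊ with hm'
    have h1 : 2 * m ≤ m' := by
      refine Nat.le_floor ?_
      have := Nat.floor_le (show 0 ≤ 2 ^ n * t by positivity)
      push_cast
      rw [pow_succ]
      linarith
    have h2 : m' ≤ 2 * m + 1 := by
      refine Nat.le_of_lt_succ ((Nat.floor_lt (by positivity)).2 ?_)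
      have := Nat.lt_floor_add_one (2 ^ n * t)
      push_cast
      rw [pow_succ]
      linarith
    have hfl : dyadicFloor n t = ((2 * m : ℕ) : ℝ) / 2 ^ (n + 1) := by
      rw [dyadicFloor, ← hm, pow_succ]; push_cast; field_simp
    have hle : dyadicFloor n t ≤ dyadicFloor (n + 1) t := by
      rw [hfl, dyadicFloor, ← hm']; gcongr
    have hle' : dyadicFloor (n + 1) t ≤ t := dyadicFloor_le ht0
    have hA1 : |A (dyadicFloor n t) (dyadicFloor (n + 1) t)| ≤ R * q ^ n := by
      rcases (show m' = 2 * m ∨ m' = 2 * m + 1 by omega) with h | h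
      · have : dyadicFloor (n + 1) t = dyadicFloor n t := by rw [hfl, dyadicFloor, ← hm', h]
        have h3 := hlip _ _ (dyadicFloor_nonneg n t) hle (hle'.trans ht)
        rw [this, sub_self, mul_zero] at h3
        rw [this]
        exact h3.trans (by positivity)
      · have hlt : 2 * m < 2 ^ (n + 1) := by
          have : m' ≤ 2 ^ (n + 1) := by
            refine Nat.floor_le_of_le ?_
            push_cast
            exact mul_le_of_le_one_right (by positivity) ht
          omega
        have h3 := hdyadic (n + 1) (2 * m) hlt
        rw [hfl, dyadicFloor, ← hm', h]
        push_cast at h3 ⊢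
        refine h3.trans (mul_le_mul_of_nonneg_left ?_ hR)
        exact pow_le_pow_of_le_one hq0.le hq1.le n.le_succ
    have hA2 := hadd _ _ _ (dyadicFloor_nonneg n t) hle hle' ht
    have hA3 : (t - dyadicFloor n t) ^ γ ≤ q ^ n := by
      rw [hq, ← one_half_pow_rpow]
      exact Real.rpow_le_rpow (by linarith) (by linarith [lt_dyadicFloor_add n t]) hγ.le
    have hA4 := mul_le_mul_of_nonneg_left hA3 hL
    have : A (dyadicFloor n t) t = (A (dyadicFloor n t) t -
        A (dyadicFloor n t) (dyadicFloor (n + 1) t) - A (dyadicFloor (n + 1) t) t) +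
        A (dyadicFloor n t) (dyadicFloor (n + 1) t) + A (dyadicFloor (n + 1) t) t := by ring
    rw [this]
    refine (abs_add_three _ _ _).trans ?_
    linarith
  have hiter : ∀ N, |A (dyadicFloor n t) t| ≤
      (R + L) / (1 - q) * (q ^ n - q ^ (n + N)) + |A (dyadicFloor (n + N) t) t| := by
    intro N
    induction N with
    | zero => simp
    | succ N ih =>
      have h := hstep (n + N)
      have e : (R + L) / (1 - q) * (q ^ n - q ^ (n + (N + 1))) =
          (R + L) / (1 - q) * (q ^ n - q ^ (n + N)) + (R + L) * q ^ (n + N) := by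
        have : 1 - q ≠ 0 := by linarith
        rw [← add_assoc, pow_succ]
        field_simp
        ring
      rw [e, ← add_assoc n N 1]
      linarith
  -- the Lipschitz bound makes the remainder vanish; its constant does not enter the result
  have hlim : Filter.Tendsto (fun N : ℕ => (R + L) / (1 - q) * q ^ n + |Λ| * (1 / 2) ^ N)
      Filter.atTop (nhds ((R + L) / (1 - q) * q ^ n + |Λ| * 0)) :=
    tendsto_const_nhds.add ((tendsto_pow_atTop_nhds_zero_of_lt_one
      (by norm_num) (by norm_num)).const_mul _)
  rw [mul_zero, add_zero] at hlim
  refine ge_of_tendsto' hlim fun N => (hiter N).trans (add_le_add ?_ ?_)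
  · have : 0 ≤ (R + L) / (1 - q) := div_nonneg (by positivity) (by linarith)
    exact mul_le_mul_of_nonneg_left (by linarith [pow_pos hq0 (n + N)]) this
  · have hle : dyadicFloor (n + N) t ≤ t := dyadicFloor_le ht0
    refine (hlip _ _ (dyadicFloor_nonneg _ t) hle ht).trans ?_
    refine mul_le_mul (le_abs_self _) ?_ (by linarith) (abs_nonneg _)
    have h1 := lt_dyadicFloor_add (n + N) t
    have h2 : ((1 : ℝ) / 2) ^ (n + N) ≤ (1 / 2) ^ N :=
      pow_le_pow_of_le_one (by norm_num) (by norm_num) (Nat.le_add_left _ _)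
    linarith

/-- The constant of the chaining bound. -/
def chainConst (γ : ℝ) : ℝ := (1 + 2 * 4 ^ γ + 2 / (1 - (1 / 2) ^ γ)) * 2 ^ γ

theorem chainConst_pos (hγ : 0 < γ) : 0 < chainConst γ := by
  have hq1 : ((1 : ℝ) / 2) ^ γ < 1 := Real.rpow_lt_one (by norm_num) (by norm_num) hγ
  have : 0 ≤ 2 / (1 - ((1 : ℝ) / 2) ^ γ) := div_nonneg (by norm_num) (by linarith)
  unfold chainConst
  positivity

/-- Chaining: an almost additive two-parameter function of order `γ` on the dyadic intervals is of
order `γ`. -/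
theorem abs_le_of_dyadic (hγ : 0 < γ) (hR : 0 ≤ R) (hL : 0 ≤ L)
    (hdyadic : ∀ n k : ℕ, k < 2 ^ n →
      |A (k / 2 ^ n) ((k + 1) / 2 ^ n)| ≤ R * ((1 / 2) ^ γ) ^ n)
    (hadd : ∀ s u t, 0 ≤ s → s ≤ u → u ≤ t → t ≤ 1 →
      |A s t - A s u - A u t| ≤ L * (t - s) ^ γ)
    (hlip : ∀ s t, 0 ≤ s → s ≤ t → t ≤ 1 → |A s t| ≤ Λ * (t - s))
    {s t : ℝ} (hs : 0 ≤ s) (hst : s ≤ t) (ht : t ≤ 1) :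
    |A s t| ≤ chainConst γ * (R + L) * (t - s) ^ γ := by
  rcases hst.eq_or_lt with rfl | hlt
  · have h := hlip s s hs le_rfl ht
    rw [sub_self, mul_zero] at h
    rw [sub_self, Real.zero_rpow hγ.ne', mul_zero]
    exact h
  set q : ℝ := (1 / 2) ^ γ with hq
  have hq0 : 0 < q := by positivity
  have hq1 : q < 1 := Real.rpow_lt_one (by norm_num) (by norm_num) hγ
  -- the level `n` with `2^{-(n+1)} < t - s ≤ 2^{-n}`
  obtain ⟨n, hn1, hn2⟩ := exists_nat_pow_near_of_lt_one (sub_pos.2 hlt)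
    (show t - s ≤ 1 by linarith) (show (0 : ℝ) < 1 / 2 by norm_num) (by norm_num)
  set a := dyadicFloor n s with ha
  set b := dyadicFloor n t with hb
  have ha0 : 0 ≤ a := dyadicFloor_nonneg n s
  have has : a ≤ s := dyadicFloor_le hs
  have hbt : b ≤ t := dyadicFloor_le (hs.trans hst)
  have hsa : s < a + (1 / 2) ^ n := lt_dyadicFloor_add n s
  have hab : a ≤ b := by
    rw [ha, hb, dyadicFloor, dyadicFloor]
    gcongr
  have hA1 : |A a b| ≤ R * q ^ n := by
    have h1 : ⌊2 ^ n * s⌋₊ ≤ ⌊2 ^ n * t⌋₊ := Nat.floor_mono (by gcongr)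
    have h2 : ⌊2 ^ n * t⌋₊ ≤ ⌊2 ^ n * s⌋₊ + 1 := by
      refine Nat.le_of_lt_succ ((Nat.floor_lt (by have := hs.trans hst; positivity)).2 ?_)
      have h3 := Nat.lt_floor_add_one (2 ^ n * s)
      have h4 : 2 ^ n * (t - s) ≤ 1 := by
        calc (2 : ℝ) ^ n * (t - s) ≤ 2 ^ n * (1 / 2) ^ n := by gcongr
          _ = 1 := by rw [← mul_pow]; norm_num
      push_cast
      linarith
    rcases (show ⌊2 ^ n * t⌋₊ = ⌊2 ^ n * s⌋₊ ∨ ⌊2 ^ n * t⌋₊ = ⌊2 ^ n * s⌋₊ + 1 by omega)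
      with h | h
    · have : b = a := by rw [ha, hb, dyadicFloor, dyadicFloor, h]
      have h3 := hlip a a ha0 le_rfl (has.trans (hst.trans ht))
      rw [sub_self, mul_zero] at h3
      rw [this]
      exact h3.trans (by positivity)
    · have hlt' : ⌊2 ^ n * s⌋₊ < 2 ^ n := by
        have : ⌊2 ^ n * t⌋₊ ≤ 2 ^ n := by
          refine Nat.floor_le_of_le ?_
          push_cast
          exact mul_le_of_le_one_right (by positivity) ht
        omega
      have h3 := hdyadic n _ hlt'
      rw [ha, hb, dyadicFloor, dyadicFloor, h]
      push_cast
      exact h3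
  -- compare `(s, t)` with `(a, b)`: both fit into `(a, t)`, whose length is at most `2 * 2^{-n}`
  have hta : (t - a) ^ γ ≤ 4 ^ γ * q ^ n := by
    rw [hq, ← one_half_pow_rpow, ← Real.mul_rpow (by norm_num) (by positivity)]
    exact Real.rpow_le_rpow (by linarith) (by linarith) hγ.le
  have hA2 := hadd a s t ha0 has hst ht
  have hA3 := hadd a b t ha0 hab hbt ht
  have hA4 := abs_dyadicFloor_le hγ hR hL hdyadic hadd hlip n hs (hst.trans ht)
  have hA5 := abs_dyadicFloor_le hγ hR hL hdyadic hadd hlip n (hs.trans hst) ht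
  rw [← ha, ← hq] at hA4
  rw [← hb, ← hq] at hA5
  have hLt := mul_le_mul_of_nonneg_left hta hL
  have e : A s t = (A a t - A a b - A b t) - (A a t - A a s - A s t) + A a b + A b t - A a s := by
    ring
  have hbound : |A s t| ≤ (R + 2 * (L * 4 ^ γ) + 2 * ((R + L) / (1 - q))) * q ^ n := by
    rw [e]
    have h1 := abs_sub ((A a t - A a b - A b t) - (A a t - A a s - A s t) + A a b + A b t) (A a s)
    have h2 := abs_add_three ((A a t - A a b - A b t) - (A a t - A a s - A s t)) (A a b) (A b t)
    have h3 := abs_sub (A a t - A a b - A b t) (A a t - A a s - A s t)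
    nlinarith
  have hqn : q ^ n ≤ 2 ^ γ * (t - s) ^ γ := by
    rw [hq, ← one_half_pow_rpow, ← Real.mul_rpow (by norm_num) (by linarith)]
    refine Real.rpow_le_rpow (by positivity) ?_ hγ.le
    rw [pow_succ] at hn1
    linarith
  have hq1' : 0 < 1 - q := by linarith
  have h4 : (0 : ℝ) ≤ 4 ^ γ := by positivity
  calc |A s t| ≤ (R + 2 * (L * 4 ^ γ) + 2 * ((R + L) / (1 - q))) * q ^ n := hbound
    _ ≤ ((R + L) + 2 * ((R + L) * 4 ^ γ) + 2 * ((R + L) / (1 - q))) *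
        (2 ^ γ * (t - s) ^ γ) := by
        gcongr
        · linarith
        · linarith
    _ = chainConst γ * (R + L) * (t - s) ^ γ := by
        rw [chainConst, ← hq]; ring

end Chaining

/-! ### Hölder spaces: vector space structure and compact sets -/

section HolderModule

variable {ν : ℝ} {V : Type*} [NormedAddCommGroup V] [NormedSpace ℝ V]

instance : Module ℝ (HolderTwo ν V) := inferInstanceAs (Module ℝ (holderTwo ν V))

instance : Module ℝ (HolderOne ν V) := inferInstanceAs (Module ℝ (holderOne ν V))

theorem holderNorm_smul_le (c : ℝ) (f : C(I × I, V)) :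
    holderNorm ν (c • f) ≤ ‖c‖ * holderNorm ν f := by
  unfold holderNorm
  rw [Real.mul_iSup_of_nonneg (norm_nonneg c)]
  refine le_of_eq (iSup_congr fun p => ?_)
  rw [ContinuousMap.smul_apply, norm_smul, mul_div_assoc]

instance : NormedSpace ℝ (HolderTwo ν V) where
  norm_smul_le c f := holderNorm_smul_le c f.1

instance : NormedSpace ℝ (HolderOne ν V) where
  norm_smul_le c f := by
    change ‖c • f.1 0‖ + holderNorm ν (increment V (c • f.1)) ≤
      ‖c‖ * (‖f.1 0‖ + holderNorm ν (increment V f.1))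
    rw [map_smul, norm_smul, mul_add]
    exact add_le_add le_rfl (holderNorm_smul_le c _)

end HolderModule

section HolderCompact

variable {V : Type*} [NormedAddCommGroup V] {b ν C : ℝ}

theorem abs_sub_unitInterval_le_one (s t : I) : |(t : ℝ) - s| ≤ 1 :=
  abs_sub_le_iff.2 ⟨by linarith [s.2.1, t.2.2], by linarith [s.2.2, t.2.1]⟩

/-- Interpolation between the uniform norm and a stronger Hölder bound. -/
theorem holderNorm_le_of_interpolation (hν : 0 < ν) (hνb : ν < b) (hC : 0 ≤ C)
    (f : C(I × I, V)) (hf : ∀ s t : I, ‖f (s, t)‖ ≤ C * |(t : ℝ) - s| ^ b) :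
    holderNorm ν f ≤ C ^ (ν / b) * ‖f‖ ^ (1 - ν / b) := by
  have hb : 0 < b := hν.trans hνb
  have hθ : 0 < 1 - ν / b := by rw [sub_pos, div_lt_one hb]; exact hνb
  refine ciSup_le fun p => div_le_of_le_mul₀ (by positivity) (by positivity) ?_
  have h1 : ‖f p‖ = ‖f p‖ ^ (ν / b) * ‖f p‖ ^ (1 - ν / b) := by
    rw [← Real.rpow_add_of_nonneg (norm_nonneg _) (by positivity) hθ.le]
    simp
  have h2 : ‖f p‖ ^ (ν / b) ≤ C ^ (ν / b) * |(p.2 : ℝ) - p.1| ^ ν := by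
    calc ‖f p‖ ^ (ν / b) ≤ (C * |(p.2 : ℝ) - p.1| ^ b) ^ (ν / b) :=
          Real.rpow_le_rpow (norm_nonneg _) (hf p.1 p.2) (by positivity)
      _ = _ := by
        rw [Real.mul_rpow hC (by positivity), ← Real.rpow_mul (abs_nonneg _),
          mul_div_cancel₀ _ hb.ne']
  rw [h1]
  calc ‖f p‖ ^ (ν / b) * ‖f p‖ ^ (1 - ν / b)
      ≤ (C ^ (ν / b) * |(p.2 : ℝ) - p.1| ^ ν) * ‖f‖ ^ (1 - ν / b) :=
        mul_le_mul h2 (Real.rpow_le_rpow (norm_nonneg _) (f.norm_coe_le_norm p) hθ.le)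
          (by positivity) (by positivity)
    _ = _ := by ring

/-- Arzelà–Ascoli for a set of functions given by a pointwise closed condition which implies a
uniform bound and a common modulus of continuity. -/
theorem isCompact_of_modulus {X : Type*} [TopologicalSpace X] [ProperSpace V] {T : Set (X → V)}
    (hT : IsClosed T) (hb : ∀ f ∈ T, ∀ x, ‖f x‖ ≤ C) {w : X → X → ℝ}
    (hw : ∀ x, Filter.Tendsto (w x) (nhds x) (nhds 0))
    (hmod : ∀ f ∈ T, ∀ x y, dist (f x) (f y) ≤ w x y) :
    IsCompact {f : C(X, V) | ⇑f ∈ T} := by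
  have himage : ContinuousMap.toFun '' {f : C(X, V) | ⇑f ∈ T} = T := by
    ext f
    constructor
    · rintro ⟨g, hg, rfl⟩
      exact hg
    · intro hf
      refine ⟨⟨f, continuous_iff_continuousAt.2 fun x => ?_⟩, hf, rfl⟩
      refine tendsto_iff_dist_tendsto_zero.2 (squeeze_zero (fun _ => dist_nonneg)
        (fun y => ?_) (hw x))
      rw [dist_comm]
      exact hmod f hf x y
  refine ArzelaAscoli.isCompact_of_equicontinuous _ ?_ fun x => ?_
  · rw [himage]
    refine (isCompact_univ_pi fun _ : X => isCompact_closedBall (0 : V) C).of_isClosed_subset hT ?_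
    intro f hf x _
    simpa using hb f hf x
  · exact Metric.equicontinuousAt_of_continuity_modulus (w x) (hw x) _
      (Filter.Eventually.of_forall fun y f => hmod _ f.2 x y)

theorem isClosed_pi_norm_le {X : Type*} {Φ : (X → V) → V} (hΦ : Continuous Φ) (c : ℝ) :
    IsClosed {f | ‖Φ f‖ ≤ c} :=
  isClosed_le hΦ.norm continuous_const

/-- Paths started from `0` with `b`-Hölder constant at most `C`. -/
def pathBall (V : Type*) [NormedAddCommGroup V] (C b : ℝ) : Set (I → V) :=
  {x | x 0 = 0 ∧ ∀ s t : I, ‖x t - x s‖ ≤ C * |(t : ℝ) - s| ^ b}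

/-- Two-parameter functions of order `2b` which are almost additive, as in Chen's relation. -/
def areaBall (V : Type*) [NormedAddCommGroup V] (C b : ℝ) : Set (I × I → V) :=
  {y | (∀ s t : I, ‖y (s, t)‖ ≤ C * |(t : ℝ) - s| ^ (2 * b)) ∧
    ∀ s u t : I, ‖y (s, t) - y (s, u) - y (u, t)‖ ≤ C * (|(u : ℝ) - s| ^ b * |(t : ℝ) - u| ^ b)}

theorem tendsto_abs_sub_rpow (hb : 0 < b) {X : Type*} [TopologicalSpace X] {φ : X → I}
    (hφ : Continuous φ) (x : X) :
    Filter.Tendsto (fun y => |(φ y : ℝ) - φ x| ^ b) (nhds x) (nhds 0) := by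
  have h : Continuous fun y => |(φ y : ℝ) - φ x| ^ b :=
    Continuous.rpow_const (by fun_prop) fun _ => Or.inr hb.le
  simpa [hb.ne'] using h.tendsto x

theorem isCompact_pathBall [ProperSpace V] (hb : 0 < b) (hC : 0 ≤ C) :
    IsCompact {x : C(I, V) | ⇑x ∈ pathBall V C b} := by
  refine isCompact_of_modulus (C := C) (w := fun s t => C * |(t : ℝ) - s| ^ b) ?_ ?_ ?_ ?_
  · have h : pathBall V C b = {x | x 0 = 0} ∩
        ⋂ s : I, ⋂ t : I, {x | ‖x t - x s‖ ≤ C * |(t : ℝ) - s| ^ b} := by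
      ext x
      simp only [pathBall, mem_inter_iff, mem_ofPred_eq, mem_iInter]
    rw [h]
    refine (isClosed_eq (continuous_apply _) continuous_const).inter
      (isClosed_iInter fun s => isClosed_iInter fun t =>
        isClosed_pi_norm_le (Φ := fun x : I → V => x t - x s) (by fun_prop) _)
  · intro x hx t
    have h := hx.2 0 t
    rw [hx.1, sub_zero] at h
    exact h.trans (mul_le_of_le_one_right hC (Real.rpow_le_one (abs_nonneg _)
      (abs_sub_unitInterval_le_one _ _) hb.le))
  · intro s
    simpa using (tendsto_abs_sub_rpow hb continuous_id s).const_mul C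
  · intro x hx s t
    rw [dist_comm, dist_eq_norm]
    exact hx.2 s t

/-- The almost additivity is what gives a modulus of continuity: order `2b` alone does not. -/
theorem isCompact_areaBall [ProperSpace V] (hb : 0 < b) (hC : 0 ≤ C) :
    IsCompact {y : C(I × I, V) | ⇑y ∈ areaBall V C b} := by
  have hle1 : ∀ s t : I, |(t : ℝ) - s| ^ b ≤ 1 := fun s t =>
    Real.rpow_le_one (abs_nonneg _) (abs_sub_unitInterval_le_one _ _) hb.le
  have hle2 : ∀ s t : I, |(t : ℝ) - s| ^ (2 * b) ≤ |(t : ℝ) - s| ^ b := fun s t =>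
    Real.rpow_le_rpow_of_exponent_ge_of_imp (abs_nonneg _) (abs_sub_unitInterval_le_one _ _)
      (by linarith) fun _ h => absurd h (by positivity)
  refine isCompact_of_modulus (C := C) (w := fun p p' =>
    2 * C * |(p'.1 : ℝ) - p.1| ^ b + 2 * C * |(p'.2 : ℝ) - p.2| ^ b) ?_ ?_ ?_ ?_
  · have h : areaBall V C b = (⋂ s : I, ⋂ t : I,
        {y : I × I → V | ‖y (s, t)‖ ≤ C * |(t : ℝ) - s| ^ (2 * b)}) ∩
        ⋂ s : I, ⋂ u : I, ⋂ t : I, {y : I × I → V | ‖y (s, t) - y (s, u) - y (u, t)‖ ≤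
          C * (|(u : ℝ) - s| ^ b * |(t : ℝ) - u| ^ b)} := by
      ext y
      simp only [areaBall, mem_inter_iff, mem_ofPred_eq, mem_iInter]
    rw [h]
    exact (isClosed_iInter fun s => isClosed_iInter fun t =>
        isClosed_pi_norm_le (Φ := fun y : I × I → V => y (s, t)) (by fun_prop) _).inter
      (isClosed_iInter fun s => isClosed_iInter fun u => isClosed_iInter fun t =>
        isClosed_pi_norm_le (Φ := fun y : I × I → V => y (s, t) - y (s, u) - y (u, t))
          (by fun_prop) _)
  · intro y hy p
    exact (hy.1 p.1 p.2).trans (mul_le_of_le_one_right hC ((hle2 _ _).trans (hle1 _ _)))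
  · intro p
    have h1 := (tendsto_abs_sub_rpow hb continuous_fst p).const_mul (2 * C)
    have h2 := (tendsto_abs_sub_rpow hb continuous_snd p).const_mul (2 * C)
    simpa using h1.add h2
  · rintro y hy ⟨s, t⟩ ⟨s', t'⟩
    have e1 := hy.2 s s' t
    have e2 := hy.2 s' t' t
    have f1 := hy.1 s s'
    have f2 := hy.1 t' t
    rw [abs_sub_comm (t : ℝ) t'] at f2 e2
    have g1 : C * (|(s' : ℝ) - s| ^ b * |(t : ℝ) - s'| ^ b) ≤ C * |(s' : ℝ) - s| ^ b :=
      mul_le_mul_of_nonneg_left (mul_le_of_le_one_right (by positivity) (hle1 _ _)) hC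
    have g2 : C * (|(t' : ℝ) - s'| ^ b * |(t' : ℝ) - t| ^ b) ≤ C * |(t' : ℝ) - t| ^ b :=
      mul_le_mul_of_nonneg_left (mul_le_of_le_one_left (by positivity) (hle1 _ _)) hC
    have k1 := mul_le_mul_of_nonneg_left (hle2 s s') hC
    have k2 := mul_le_mul_of_nonneg_left (hle2 t t') hC
    have e : y (s, t) - y (s', t') = (y (s, t) - y (s, s') - y (s', t)) +
        (y (s', t) - y (s', t') - y (t', t)) + y (s, s') + y (t', t) := by abel
    rw [dist_eq_norm, e]
    refine (norm_add_le _ _).trans ?_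
    have n1 := norm_add₃_le (a := y (s, t) - y (s, s') - y (s', t))
      (b := y (s', t) - y (s', t') - y (t', t)) (c := y (s, s'))
    simp only
    linarith

theorem rpow_le_rpow_unitInterval (hν : 0 < ν) (hνb : ν < b) (s t : I) :
    |(t : ℝ) - s| ^ b ≤ |(t : ℝ) - s| ^ ν :=
  Real.rpow_le_rpow_of_exponent_ge_of_imp (abs_nonneg _) (abs_sub_unitInterval_le_one _ _)
    hνb.le fun _ h => absurd h (hν.trans hνb).ne'

variable [NormedSpace ℝ V]

theorem mem_holderTwo_of_le (hν : 0 < ν) (hνb : ν < b) (hC : 0 ≤ C) {f : C(I × I, V)}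
    (hf : ∀ s t : I, ‖f (s, t)‖ ≤ C * |(t : ℝ) - s| ^ b) : f ∈ holderTwo ν V :=
  ⟨C, fun s t => (hf s t).trans
    (mul_le_mul_of_nonneg_left (rpow_le_rpow_unitInterval hν hνb s t) hC)⟩

theorem norm_holderTwo_sub (f g : HolderTwo ν V) : ‖f - g‖ = holderNorm ν (f.1 - g.1) := rfl

theorem norm_holderOne_sub (f g : HolderOne ν V) :
    ‖f - g‖ = ‖f.1 0 - g.1 0‖ + holderNorm ν (increment V (f.1 - g.1)) := rfl

theorem tendsto_interpolation {X : Type*} [PseudoMetricSpace X] (hν : 0 < ν) (hνb : ν < b)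
    (D E : ℝ) (x : X) :
    Filter.Tendsto (fun y => D * (E * dist y x) ^ (1 - ν / b)) (nhds x) (nhds 0) := by
  have hθ : 0 < 1 - ν / b := by rw [sub_pos, div_lt_one (hν.trans hνb)]; exact hνb
  have h : Continuous fun y => D * (E * dist y x) ^ (1 - ν / b) :=
    continuous_const.mul (Continuous.rpow_const (by fun_prop) fun _ => Or.inr hθ.le)
  simpa [hθ.ne'] using h.tendsto x

/-- Balls of a stronger Hölder norm are compact in the space of paths. -/
theorem isCompact_holderOne [ProperSpace V] (hν : 0 < ν) (hνb : ν < b) (hC : 0 ≤ C) :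
    IsCompact {x : HolderOne ν V | ⇑x.1 ∈ pathBall V C b} := by
  have hmem : ∀ x : C(I, V), ⇑x ∈ pathBall V C b → x ∈ holderOne ν V := fun x hx =>
    mem_holderTwo_of_le hν hνb hC (f := increment V x) fun s t => hx.2 s t
  let ι : {x : C(I, V) | ⇑x ∈ pathBall V C b} → HolderOne ν V := fun x => ⟨x.1, hmem x.1 x.2⟩
  have hι : Continuous ι := by
    refine continuous_iff_continuousAt.2 fun x => tendsto_iff_dist_tendsto_zero.2 ?_
    refine squeeze_zero (fun _ => dist_nonneg) (fun y => ?_)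
      (tendsto_interpolation hν hνb ((2 * C) ^ (ν / b)) 2 x)
    have h0 : (ι y).1 0 - (ι x).1 0 = 0 := by
      change y.1 0 - x.1 0 = 0
      rw [y.2.1, x.2.1, sub_zero]
    rw [dist_eq_norm, norm_holderOne_sub, h0, norm_zero, zero_add]
    refine (holderNorm_le_of_interpolation hν hνb (C := 2 * C) (by positivity) _
      fun s t => ?_).trans ?_
    · have h1 := y.2.2 s t
      have h2 := x.2.2 s t
      change ‖(y.1 t - x.1 t) - (y.1 s - x.1 s)‖ ≤ _
      rw [show (y.1 t - x.1 t) - (y.1 s - x.1 s) = (y.1 t - y.1 s) - (x.1 t - x.1 s) by abel]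
      refine (norm_sub_le _ _).trans ?_
      linarith
    · have hθ : 0 < 1 - ν / b := by rw [sub_pos, div_lt_one (hν.trans hνb)]; exact hνb
      refine mul_le_mul_of_nonneg_left (Real.rpow_le_rpow (norm_nonneg _) ?_ hθ.le)
        (by positivity)
      refine (ContinuousMap.norm_le _ (by positivity)).2 fun p => ?_
      change ‖(y.1 - x.1) p.2 - (y.1 - x.1) p.1‖ ≤ _
      refine (norm_sub_le _ _).trans ?_
      have h1 := (y.1 - x.1).norm_coe_le_norm p.1
      have h2 := (y.1 - x.1).norm_coe_le_norm p.2
      rw [Subtype.dist_eq, dist_eq_norm]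
      linarith
  have hcomp : CompactSpace {x : C(I, V) | ⇑x ∈ pathBall V C b} :=
    isCompact_iff_compactSpace.1 (isCompact_pathBall (hν.trans hνb) hC)
  convert isCompact_range hι
  ext x
  exact ⟨fun hx => ⟨⟨x.1, hx⟩, rfl⟩, by rintro ⟨y, rfl⟩; exact y.2⟩

/-- Almost additive functions bounded in a stronger Hölder norm form a compact set. -/
theorem isCompact_holderTwo [ProperSpace V] (hν : 0 < ν) (hνb : ν < b) (hC : 0 ≤ C) :
    IsCompact {y : HolderTwo (2 * ν) V | ⇑y.1 ∈ areaBall V C b} := by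
  have hν2 : 0 < 2 * ν := by linarith
  have hνb2 : 2 * ν < 2 * b := by linarith
  have hmem : ∀ y : C(I × I, V), ⇑y ∈ areaBall V C b → y ∈ holderTwo (2 * ν) V := fun y hy =>
    mem_holderTwo_of_le hν2 hνb2 hC fun s t => hy.1 s t
  let ι : {y : C(I × I, V) | ⇑y ∈ areaBall V C b} → HolderTwo (2 * ν) V :=
    fun y => ⟨y.1, hmem y.1 y.2⟩
  have hι : Continuous ι := by
    refine continuous_iff_continuousAt.2 fun x => tendsto_iff_dist_tendsto_zero.2 ?_
    refine squeeze_zero (fun _ => dist_nonneg) (fun y => ?_)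
      (tendsto_interpolation hν2 hνb2 ((2 * C) ^ (2 * ν / (2 * b))) 1 x)
    rw [dist_eq_norm, norm_holderTwo_sub, one_mul, Subtype.dist_eq, dist_eq_norm]
    refine holderNorm_le_of_interpolation hν2 hνb2 (C := 2 * C) (by positivity) _ fun s t => ?_
    have h1 := y.2.1 s t
    have h2 := x.2.1 s t
    refine (norm_sub_le _ _).trans ?_
    change ‖y.1 (s, t)‖ + ‖x.1 (s, t)‖ ≤ _
    linarith
  have hcomp : CompactSpace {y : C(I × I, V) | ⇑y ∈ areaBall V C b} :=
    isCompact_iff_compactSpace.1 (isCompact_areaBall (hν.trans hνb) hC)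
  convert isCompact_range hι
  ext x
  exact ⟨fun hx => ⟨⟨x.1, hx⟩, rfl⟩, by rintro ⟨y, rfl⟩; exact y.2⟩

end HolderCompact

/-! ### Paths and areas as functions of the driving sequences -/

section PathArea

variable {H ε : ℝ} {z w : ℕ → ℝ} {s t u : ℝ}

/-- The path driven by the sequence `z`. -/
def noisePath (H ε : ℝ) (z : ℕ → ℝ) (t : ℝ) : ℝ := ∫ u in (0 : ℝ)..t, velocity H ε z u

/-- The iterated integral `∫_s^t (x^w_r - x^w_s) dx^z_r` of the paths driven by `w` and `z`. -/
def noiseArea (H ε : ℝ) (z w : ℕ → ℝ) (s t : ℝ) : ℝ :=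
  ∫ r in s..t, (noisePath H ε w r - noisePath H ε w s) * velocity H ε z r

/-- A bound for the velocity on `[0,1]`. -/
def speedBound (H ε : ℝ) (z : ℕ → ℝ) : ℝ :=
  ε ^ (H - 1 / 2) * noiseBound ε z + |H - 1 / 2| * ε ^ (H - 3 / 2) * noiseBound ε z

theorem abs_velocity_le_speedBound (hH : H < 1 / 2) (hε : 0 < ε) (hu : u ≤ 1) :
    |velocity H ε z u| ≤ speedBound H ε z :=
  abs_velocity_le hH hε hu

theorem speedBound_nonneg (hH : H < 1 / 2) (hε : 0 < ε) : 0 ≤ speedBound H ε z :=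
  (abs_nonneg _).trans (abs_velocity_le_speedBound hH hε (zero_le_one))

theorem integrableOn_velocity (hH : H < 1 / 2) (hε : 0 < ε) :
    IntegrableOn (velocity H ε z) (Icc 0 1) :=
  (integrableOn_Icc_iff_integrableOn_Ioc).2
    (integrableOn_of_abs_le measurable_velocity fun _ hr => abs_velocity_le hH hε hr.2)

theorem intervalIntegrable_velocity (hH : H < 1 / 2) (hε : 0 < ε) (hs : s ∈ Icc (0 : ℝ) 1)
    (ht : t ∈ Icc (0 : ℝ) 1) : IntervalIntegrable (velocity H ε z) volume s t :=
  ((integrableOn_velocity hH hε).mono_set (uIcc_subset_Icc hs ht)).intervalIntegrable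

theorem noisePath_sub (hH : H < 1 / 2) (hε : 0 < ε) (hs : s ∈ Icc (0 : ℝ) 1)
    (ht : t ∈ Icc (0 : ℝ) 1) :
    noisePath H ε z t - noisePath H ε z s = ∫ u in s..t, velocity H ε z u :=
  intervalIntegral.integral_interval_sub_left
    (intervalIntegrable_velocity hH hε ⟨le_rfl, zero_le_one⟩ ht)
    (intervalIntegrable_velocity hH hε ⟨le_rfl, zero_le_one⟩ hs)

theorem noisePath_zero : noisePath H ε z 0 = 0 := by simp [noisePath]

theorem abs_noisePath_sub_le (hH : H < 1 / 2) (hε : 0 < ε) (hs : s ∈ Icc (0 : ℝ) 1)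
    (ht : t ∈ Icc (0 : ℝ) 1) :
    |noisePath H ε z t - noisePath H ε z s| ≤ speedBound H ε z * |t - s| := by
  rw [noisePath_sub hH hε hs ht]
  have h : ∀ u ∈ uIoc s t, ‖velocity H ε z u‖ ≤ speedBound H ε z := fun u hu =>
    abs_velocity_le_speedBound hH hε (uIcc_subset_Icc hs ht (uIoc_subset_uIcc hu)).2
  exact intervalIntegral.norm_integral_le_of_norm_le_const h

theorem continuousOn_noisePath (hH : H < 1 / 2) (hε : 0 < ε) :
    ContinuousOn (noisePath H ε z) (Icc 0 1) := by
  have h : LipschitzOnWith (speedBound H ε z).toNNReal (noisePath H ε z) (Icc 0 1) := by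
    refine LipschitzOnWith.of_dist_le_mul fun t ht s hs => ?_
    rw [Real.coe_toNNReal _ (speedBound_nonneg hH hε)]
    exact abs_noisePath_sub_le hH hε hs ht
  exact h.continuousOn

theorem intervalIntegrable_mul_velocity (hH : H < 1 / 2) (hε : 0 < ε) {f : ℝ → ℝ}
    (hf : ContinuousOn f (Icc 0 1)) (hs : s ∈ Icc (0 : ℝ) 1) (ht : t ∈ Icc (0 : ℝ) 1) :
    IntervalIntegrable (fun r => f r * velocity H ε z r) volume s t :=
  (intervalIntegrable_velocity hH hε hs ht).continuousOn_mul (hf.mono (uIcc_subset_Icc hs ht))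

/-- Chen's relation. -/
theorem noiseArea_chen (hH : H < 1 / 2) (hε : 0 < ε) (hs : s ∈ Icc (0 : ℝ) 1)
    (hu : u ∈ Icc (0 : ℝ) 1) (ht : t ∈ Icc (0 : ℝ) 1) :
    noiseArea H ε z w s t - noiseArea H ε z w s u - noiseArea H ε z w u t =
      (noisePath H ε w u - noisePath H ε w s) * (noisePath H ε z t - noisePath H ε z u) := by
  have hc : ∀ c, ContinuousOn (fun r => noisePath H ε w r - c) (Icc 0 1) := fun c =>
    (continuousOn_noisePath hH hε).sub continuousOn_const
  have hi : ∀ c {p q : ℝ}, p ∈ Icc (0 : ℝ) 1 → q ∈ Icc (0 : ℝ) 1 → IntervalIntegrable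
      (fun r => (noisePath H ε w r - c) * velocity H ε z r) volume p q := fun c p q hp hq =>
    intervalIntegrable_mul_velocity hH hε (hc c) hp hq
  rw [noiseArea, noiseArea, noiseArea, noisePath_sub hH hε hu ht,
    ← intervalIntegral.integral_add_adjacent_intervals (hi _ hs hu) (hi _ hu ht),
    add_sub_cancel_left, ← intervalIntegral.integral_sub (hi _ hu ht) (hi _ hu ht),
    ← intervalIntegral.integral_const_mul]
  exact intervalIntegral.integral_congr fun r _ => by ring

theorem noiseArea_self (s : ℝ) : noiseArea H ε z w s s = 0 := by simp [noiseArea]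

theorem abs_noiseArea_le (hH : H < 1 / 2) (hε : 0 < ε) (hs : s ∈ Icc (0 : ℝ) 1)
    (ht : t ∈ Icc (0 : ℝ) 1) :
    |noiseArea H ε z w s t| ≤ speedBound H ε w * speedBound H ε z * |t - s| := by
  have h : ∀ r ∈ uIoc s t, ‖(noisePath H ε w r - noisePath H ε w s) * velocity H ε z r‖ ≤
      speedBound H ε w * speedBound H ε z := fun r hr => by
    have hr' := uIcc_subset_Icc hs ht (uIoc_subset_uIcc hr)
    rw [norm_mul]
    refine mul_le_mul ?_ (abs_velocity_le_speedBound hH hε hr'.2) (norm_nonneg _)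
      (speedBound_nonneg hH hε)
    refine (abs_noisePath_sub_le hH hε hs hr').trans
      (mul_le_of_le_one_right (speedBound_nonneg hH hε) ?_)
    exact abs_sub_le_iff.2 ⟨by linarith [hs.1, hr'.2], by linarith [hs.2, hr'.1]⟩
  exact intervalIntegral.norm_integral_le_of_norm_le_const h

/-- Chen's relation expresses the area through one-parameter functions. -/
theorem noiseArea_eq (hH : H < 1 / 2) (hε : 0 < ε) (hs : s ∈ Icc (0 : ℝ) 1)
    (ht : t ∈ Icc (0 : ℝ) 1) :
    noiseArea H ε z w s t = noiseArea H ε z w 0 t - noiseArea H ε z w 0 s -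
      noisePath H ε w s * (noisePath H ε z t - noisePath H ε z s) := by
  have h := noiseArea_chen (z := z) (w := w) hH hε (⟨le_rfl, zero_le_one⟩ : (0 : ℝ) ∈ Icc (0:ℝ) 1)
    hs ht
  rw [noisePath_zero, sub_zero] at h
  linarith

theorem continuousOn_noiseArea_zero (hH : H < 1 / 2) (hε : 0 < ε) :
    ContinuousOn (noiseArea H ε z w 0) (Icc 0 1) := by
  have h1 : IntegrableOn (fun r => (noisePath H ε w r - noisePath H ε w 0) * velocity H ε z r)
      (uIcc 0 1) := by
    rw [uIcc_of_le zero_le_one]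
    exact (intervalIntegrable_iff_integrableOn_Icc_of_le zero_le_one).1
      (intervalIntegrable_mul_velocity hH hε
        ((continuousOn_noisePath hH hε).sub continuousOn_const)
        ⟨le_rfl, zero_le_one⟩ ⟨zero_le_one, le_rfl⟩)
  have h := intervalIntegral.continuousOn_primitive_interval h1
  rwa [uIcc_of_le zero_le_one] at h

/-- The area of a path against itself is half the square of its increment. -/
theorem noiseArea_diag (hH : H < 1 / 2) (hε : 0 < ε) (hs : s ∈ Icc (0 : ℝ) 1)
    (ht : t ∈ Icc (0 : ℝ) 1) :
    noiseArea H ε z z s t = (noisePath H ε z t - noisePath H ε z s) ^ 2 / 2 := by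
  have hv : IntervalIntegrable (velocity H ε z) volume s t :=
    intervalIntegrable_velocity hH hε hs ht
  have hac := hv.absolutelyContinuousOnInterval_intervalIntegral (c := s) left_mem_uIcc
  have h1 := hac.integral_deriv_mul_eq_sub hac
  have h2 : ∫ r in s..t, deriv (fun r => ∫ u in s..r, velocity H ε z u) r *
        (∫ u in s..r, velocity H ε z u) + (∫ u in s..r, velocity H ε z u) *
          deriv (fun r => ∫ u in s..r, velocity H ε z u) r =
      ∫ r in s..t, 2 * ((noisePath H ε z r - noisePath H ε z s) * velocity H ε z r) := by
    refine intervalIntegral.integral_congr_ae ?_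
    filter_upwards [hv.ae_hasDerivAt_integral] with r hr hr'
    have hr'' := uIoc_subset_uIcc hr'
    rw [(hr hr'' s left_mem_uIcc).deriv, noisePath_sub hH hε hs (uIcc_subset_Icc hs ht hr'')]
    ring
  rw [h2, intervalIntegral.integral_const_mul, intervalIntegral.integral_same, mul_zero, sub_zero,
    ← noisePath_sub hH hε hs ht] at h1
  rw [noiseArea]
  linarith

/-! #### Linearity in the driving sequences -/

theorem noise_single (k : ℕ) (r : ℝ) : noise ε (Pi.single k 1) r = cell ε k r := by
  unfold noise cell
  by_cases h : ⌊r / ε ^ 2⌋₊ = k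
  · simp [h]
  · simp [h]

theorem velocity_eq_sum (hH : H < 1 / 2) (hε : 0 < ε) (hu : u ≤ 1) :
    velocity H ε z u =
      ∑ k ∈ Finset.range (cellCount ε), z k * velocity H ε (Pi.single k 1) u := by
  simp only [velocity, noise_single, mul_add, Finset.sum_add_distrib]
  congr 1
  · rw [noise_eq_sum hε hu, Finset.mul_sum]
    exact Finset.sum_congr rfl fun k _ => by ring
  · have hk : Measurable (kernelDeriv H ε u) :=
      measurable_kernelDeriv.comp (measurable_const.prodMk measurable_id)
    rw [integral_mul_noise hε hk fun r _ => abs_kernelDeriv_le hH hε u r]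
    rfl

theorem noisePath_eq_sum (hH : H < 1 / 2) (hε : 0 < ε) (ht : t ∈ Icc (0 : ℝ) 1) :
    noisePath H ε z t =
      ∑ k ∈ Finset.range (cellCount ε), z k * noisePath H ε (Pi.single k 1) t := by
  have h0 : (0 : ℝ) ∈ Icc (0 : ℝ) 1 := ⟨le_rfl, zero_le_one⟩
  have h1 : noisePath H ε z t = ∫ u in (0 : ℝ)..t,
      ∑ k ∈ Finset.range (cellCount ε), z k * velocity H ε (Pi.single k 1) u :=
    intervalIntegral.integral_congr fun u hu =>
      velocity_eq_sum hH hε (uIcc_subset_Icc h0 ht hu).2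
  rw [h1, intervalIntegral.integral_finsetSum fun k _ =>
    (intervalIntegrable_velocity hH hε h0 ht).const_mul _]
  simp_rw [intervalIntegral.integral_const_mul]
  rfl

theorem noiseArea_eq_sum (hH : H < 1 / 2) (hε : 0 < ε) (hs : s ∈ Icc (0 : ℝ) 1)
    (ht : t ∈ Icc (0 : ℝ) 1) :
    noiseArea H ε z w s t = ∑ k ∈ Finset.range (cellCount ε), ∑ l ∈ Finset.range (cellCount ε),
      z k * w l * noiseArea H ε (Pi.single k 1) (Pi.single l 1) s t := by
  have h1 : noiseArea H ε z w s t = ∫ r in s..t,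
      ∑ k ∈ Finset.range (cellCount ε), ∑ l ∈ Finset.range (cellCount ε), z k * w l *
        ((noisePath H ε (Pi.single l 1) r - noisePath H ε (Pi.single l 1) s) *
          velocity H ε (Pi.single k 1) r) := by
    refine intervalIntegral.integral_congr fun r hr => ?_
    have hr' := uIcc_subset_Icc hs ht hr
    rw [noisePath_eq_sum hH hε hr', noisePath_eq_sum hH hε hs, velocity_eq_sum hH hε hr'.2,
      ← Finset.sum_sub_distrib, mul_comm, Finset.sum_mul_sum]
    exact Finset.sum_congr rfl fun k _ => Finset.sum_congr rfl fun l _ => by ring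
  have hi : ∀ k l, IntervalIntegrable (fun r => z k * w l *
        ((noisePath H ε (Pi.single l 1) r - noisePath H ε (Pi.single l 1) s) *
          velocity H ε (Pi.single k 1) r)) volume s t := fun k l =>
    (intervalIntegrable_mul_velocity hH hε ((continuousOn_noisePath hH hε).sub continuousOn_const)
      hs ht).const_mul _
  have hi' : ∀ k, IntervalIntegrable (fun r => ∑ l ∈ Finset.range (cellCount ε), z k * w l *
        ((noisePath H ε (Pi.single l 1) r - noisePath H ε (Pi.single l 1) s) *
          velocity H ε (Pi.single k 1) r)) volume s t := fun k => by
    have h := IntervalIntegrable.sum (Finset.range (cellCount ε)) fun l _ => hi k l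
    simpa only [Finset.sum_fn] using h
  rw [h1, intervalIntegral.integral_finsetSum fun k _ => hi' k]
  refine Finset.sum_congr rfl fun k _ => ?_
  rw [intervalIntegral.integral_finsetSum fun l _ => hi k l]
  simp_rw [intervalIntegral.integral_const_mul]
  rfl

/-- The weight of the `k`-th entry of the driving sequence in the integral `∫_s^t f dx` against the
path. -/
def pathCoeff (H ε : ℝ) (f : ℝ → ℝ) (s t : ℝ) (k : ℕ) : ℝ :=
  cellCoeff ε (adjointWeight H ε ((Ioc s t).indicator f)) k

theorem exists_abs_indicator_le {f : ℝ → ℝ} (hf : ContinuousOn f (Icc s t)) :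
    ∃ C, ∀ r, |(Ioc s t).indicator f r| ≤ C := by
  obtain ⟨C, hC⟩ := isCompact_Icc.exists_bound_of_continuousOn hf
  refine ⟨max C 0, fun r => ?_⟩
  by_cases h : r ∈ Ioc s t
  · rw [indicator_of_mem h]; exact (hC r ⟨h.1.le, h.2⟩).trans (le_max_left _ _)
  · rw [indicator_of_notMem h, abs_zero]; exact le_max_right _ _

theorem integral_mul_velocity_eq_sum (hH : H < 1 / 2) (hε : 0 < ε) {f : ℝ → ℝ}
    (hs : 0 ≤ s) (hst : s ≤ t) (ht : t ≤ 1) (hf : ContinuousOn f (Icc s t)) :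
    ∫ r in s..t, f r * velocity H ε z r =
      ∑ k ∈ Finset.range (cellCount ε), z k * pathCoeff H ε f s t k := by
  obtain ⟨C, hC⟩ := exists_abs_indicator_le hf
  have hm := measurable_indicator_of_continuousOn hf
  rw [← setIntegral_indicator_mul_velocity hs hst ht, integral_mul_velocity hH hε hm hC,
    integral_mul_noise hε (measurable_adjointWeight hm) fun r _ => abs_adjointWeight_le hH hε hC r]
  rfl

/-- The variance of the integral of a function of size `F` and `β`-Hölder constant `M`, for
uncorrelated driving sequences of variance one. -/
theorem sum_pathCoeff_sq_le {f : ℝ → ℝ} {F M β : ℝ} (hH0 : 0 < H) (hH : H < 1 / 2) (hε : 0 < ε)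
    (hβ0 : 0 < β) (hβ : 0 < β + (H - 1 / 2))
    (hs : 0 ≤ s) (hst : s ≤ t) (ht : t ≤ 1) (hf : ContinuousOn f (Icc s t)) (hM : 0 ≤ M)
    (hfF : ∀ u ∈ Icc s t, |f u| ≤ F)
    (hfM : ∀ r ∈ Icc s t, ∀ u ∈ Icc s t, r ≤ u → |f u - f r| ≤ M * (u - r) ^ β) :
    ∑ k ∈ Finset.range (cellCount ε), pathCoeff H ε f s t k ^ 2 ≤
      (F + M * (t - s) ^ β * (|H - 1 / 2| / (β + (H - 1 / 2)))) ^ 2 * ((t - s) ^ (2 * H) / H) := by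
  obtain ⟨C, hC⟩ := exists_abs_indicator_le hf
  exact (sum_cellCoeff_sq_le hε (measurable_adjointWeight (measurable_indicator_of_continuousOn hf))
    fun r _ => abs_adjointWeight_le hH hε hC r).trans
      (integral_adjointWeight_sq_le hH0 hH hε hβ0 hβ hs hst ht hf hM hfF hfM)

theorem noisePath_sub_eq_sum (hH : H < 1 / 2) (hε : 0 < ε) (hs : 0 ≤ s) (hst : s ≤ t)
    (ht : t ≤ 1) :
    noisePath H ε z t - noisePath H ε z s =
      ∑ k ∈ Finset.range (cellCount ε), z k * pathCoeff H ε (fun _ => 1) s t k := by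
  rw [noisePath_sub hH hε ⟨hs, hst.trans ht⟩ ⟨hs.trans hst, ht⟩,
    ← integral_mul_velocity_eq_sum hH hε hs hst ht continuousOn_const]
  simp_rw [one_mul]

theorem noiseArea_eq_sum_pathCoeff (hH : H < 1 / 2) (hε : 0 < ε) (hs : 0 ≤ s) (hst : s ≤ t)
    (ht : t ≤ 1) :
    noiseArea H ε z w s t = ∑ k ∈ Finset.range (cellCount ε),
      z k * pathCoeff H ε (fun r => noisePath H ε w r - noisePath H ε w s) s t k :=
  integral_mul_velocity_eq_sum hH hε hs hst ht
    (((continuousOn_noisePath hH hε).mono (Icc_subset_Icc hs ht)).sub continuousOn_const)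

end PathArea

/-! ### Concentration and union bounds -/

section Concentration

variable {Ω : Type*} [MeasurableSpace Ω] {P : Measure Ω}

theorem hasSubgaussianMGF_mono {X : Ω → ℝ} {c c' : NNReal} (h : HasSubgaussianMGF X c P)
    (hc : c ≤ c') : HasSubgaussianMGF X c' P :=
  ⟨h.integrable_exp_mul, fun t => (h.mgf_le t).trans (Real.exp_le_exp.2 (by gcongr))⟩

/-- A sub-Gaussian tail is bounded by any inverse power. -/
theorem measure_le_abs_of_hasSubgaussianMGF [IsFiniteMeasure P] {Y : Ω → ℝ} {v : NNReal}
    (hY : HasSubgaussianMGF Y v P) {g x : ℝ} (hg : 0 < g) (hx : 0 < x) (hv : v ≤ g * x ^ 2)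
    (m : ℕ) :
    P {ω | x ≤ |Y ω|} ≤ ENNReal.ofReal (2 * (m.factorial * (2 * g) ^ m)) := by
  have hexp : ∀ Z : Ω → ℝ, HasSubgaussianMGF Z v P →
      P {ω | x ≤ Z ω} ≤ ENNReal.ofReal (m.factorial * (2 * g) ^ m) := by
    intro Z hZ
    have hZ' : HasSubgaussianMGF Z (g * x ^ 2).toNNReal P :=
      hasSubgaussianMGF_mono hZ (NNReal.coe_le_coe.1 (hv.trans (Real.le_coe_toNNReal _)))
    have h1 := hZ'.measure_ge_le hx.le
    rw [Real.coe_toNNReal _ (by positivity)] at h1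
    rw [← ofReal_measureReal]
    refine ENNReal.ofReal_le_ofReal (h1.trans ?_)
    have h2 : -x ^ 2 / (2 * (g * x ^ 2)) = -(1 / (2 * g)) := by field_simp
    have h3 := Real.pow_div_factorial_le_exp (1 / (2 * g)) (by positivity) m
    have h4 : 0 < (1 / (2 * g)) ^ m / m.factorial := by positivity
    rw [h2, Real.exp_neg]
    refine (inv_anti₀ h4 h3).trans_eq ?_
    rw [inv_div, one_div, inv_pow, div_inv_eq_mul]
  have hsub : {ω | x ≤ |Y ω|} ⊆ {ω | x ≤ Y ω} ∪ {ω | x ≤ (-Y) ω} := fun ω (hω : x ≤ |Y ω|) =>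
    (le_abs.1 hω : x ≤ Y ω ∨ x ≤ -Y ω)
  refine (measure_mono hsub).trans ((measure_union_le _ _).trans ?_)
  rw [two_mul, ENNReal.ofReal_add (by positivity) (by positivity)]
  exact add_le_add (hexp Y hY) (hexp (-Y) hY.neg)

/-- The tail of a linear form in independent sub-Gaussian variables. -/
theorem measure_le_abs_sum {X : ℕ → Ω → ℝ} {c : NNReal} (hind : iIndepFun X P)
    (hX : ∀ k, HasSubgaussianMGF (X k) c P) (N : ℕ) (a : ℕ → ℝ) {g x : ℝ} (hg : 0 < g) (hx : 0 < x)
    (ha : c * ∑ k ∈ Finset.range N, a k ^ 2 ≤ g * x ^ 2) (m : ℕ) :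
    P {ω | x ≤ |∑ k ∈ Finset.range N, X k ω * a k|} ≤
      ENNReal.ofReal (2 * (m.factorial * (2 * g) ^ m)) := by
  have : IsProbabilityMeasure P := hind.isProbabilityMeasure
  have h := HasSubgaussianMGF.sum_of_iIndepFun (s := Finset.range N)
    (hind.comp (fun k x => a k * x) fun k => measurable_const_mul _)
    fun k _ => (hX k).const_mul (a k)
  have h' : HasSubgaussianMGF (fun ω => ∑ k ∈ Finset.range N, X k ω * a k) _ P :=
    h.congr (ae_of_all _ fun ω => Finset.sum_congr rfl fun k _ => mul_comm _ _)
  refine measure_le_abs_of_hasSubgaussianMGF h' hg hx ?_ m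
  refine le_trans (le_of_eq ?_) ha
  push_cast
  rw [Finset.mul_sum]
  exact Finset.sum_congr rfl fun k _ => mul_comm _ _

/-- Union bound over the dyadic intervals of all generations. -/
theorem measure_dyadic_union_le (B : ℕ → ℕ → Set Ω) {δ : ℝ} (hδ : 0 ≤ δ)
    (hB : ∀ n k, k < 2 ^ n → P (B n k) ≤ ENNReal.ofReal (δ * (1 / 4) ^ n)) :
    P {ω | ∃ n k, k < 2 ^ n ∧ ω ∈ B n k} ≤ ENNReal.ofReal (2 * δ) := by
  have hsub : {ω | ∃ n k, k < 2 ^ n ∧ ω ∈ B n k} ⊆ ⋃ n, ⋃ k ∈ Finset.range (2 ^ n), B n k := by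
    rintro ω ⟨n, k, hk, h⟩
    exact mem_iUnion.2 ⟨n, mem_iUnion₂.2 ⟨k, Finset.mem_range.2 hk, h⟩⟩
  have hgen : ∀ n, P (⋃ k ∈ Finset.range (2 ^ n), B n k) ≤ ENNReal.ofReal (δ * (1 / 2) ^ n) := by
    intro n
    calc P (⋃ k ∈ Finset.range (2 ^ n), B n k)
        ≤ ∑ k ∈ Finset.range (2 ^ n), P (B n k) := measure_biUnion_finset_le _ _
      _ ≤ ∑ _k ∈ Finset.range (2 ^ n), ENNReal.ofReal (δ * (1 / 4) ^ n) :=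
          Finset.sum_le_sum fun k hk => hB n k (Finset.mem_range.1 hk)
      _ = ENNReal.ofReal (δ * (1 / 2) ^ n) := by
          rw [← ENNReal.ofReal_sum_of_nonneg fun _ _ => by positivity, Finset.sum_const,
            Finset.card_range, nsmul_eq_mul]
          congr 1
          push_cast
          rw [mul_left_comm, ← mul_pow]
          norm_num
  refine (measure_mono hsub).trans ((measure_iUnion_le _).trans ((ENNReal.tsum_le_tsum hgen).trans ?_))
  rw [← ENNReal.ofReal_tsum_of_nonneg (fun n => by positivity)
    (summable_geometric_two.mul_left δ), tsum_mul_left, tsum_geometric_two, mul_comm]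

/-- A bound which holds for every frozen value of an independent variable holds. -/
theorem measure_pair_mem_le_of_indepFun [IsProbabilityMeasure P] {E F : Type*} [MeasurableSpace E]
    [MeasurableSpace F] {U : Ω → E} {W : Ω → F} (hU : Measurable U) (hW : Measurable W)
    (hind : IndepFun U W P) {B : Set (E × F)} (hB : MeasurableSet B) {δ : ENNReal}
    (h : ∀ w, P {ω | (U ω, w) ∈ B} ≤ δ) : P {ω | (U ω, W ω) ∈ B} ≤ δ := by
  have := Measure.isProbabilityMeasure_map (μ := P) hU.aemeasurable
  have := Measure.isProbabilityMeasure_map (μ := P) hW.aemeasurable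
  have h1 : P {ω | (U ω, W ω) ∈ B} = P.map (fun ω => (U ω, W ω)) B :=
    (Measure.map_apply (hU.prodMk hW) hB).symm
  rw [h1, (indepFun_iff_map_prod_eq_prod_map_map hU.aemeasurable hW.aemeasurable).1 hind,
    Measure.prod_apply_symm hB]
  calc ∫⁻ w, P.map U ((fun x => (x, w)) ⁻¹' B) ∂P.map W ≤ ∫⁻ _, δ ∂P.map W := by
        refine lintegral_mono fun w => ?_
        rw [Measure.map_apply hU (hB.preimage (by fun_prop))]
        exact h w
    _ = δ := by simp

theorem comap_row_le {ι E : Type*} (η : ι → ℕ → E → ℝ) (i : ι) :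
    MeasurableSpace.comap (fun (ω : E) k => η i k ω) MeasurableSpace.pi ≤
      ⨆ p ∈ {p : ι × ℕ | p.1 = i}, MeasurableSpace.comap (η p.1 p.2) Real.measurableSpace := by
  rw [MeasurableSpace.pi, MeasurableSpace.comap_iSup]
  refine iSup_le fun k => ?_
  rw [MeasurableSpace.comap_comp]
  exact le_iSup₂_of_le (f := fun (p : ι × ℕ) (_ : p ∈ {p : ι × ℕ | p.1 = i}) =>
    MeasurableSpace.comap (η p.1 p.2) Real.measurableSpace) (i, k) rfl le_rfl

/-- Distinct rows of an independent array are independent sequences. -/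
theorem indepFun_rows {ι : Type*} {η : ι → ℕ → Ω → ℝ} (hmeas : ∀ i k, Measurable (η i k))
    (hindep : iIndepFun (fun p : ι × ℕ => η p.1 p.2) P) {i j : ι} (hij : i ≠ j) :
    IndepFun (fun ω k => η i k ω) (fun ω k => η j k ω) P := by
  rw [IndepFun_iff_Indep]
  refine indep_of_indep_of_le_left (indep_of_indep_of_le_right ?_ (comap_row_le η j))
    (comap_row_le η i)
  exact indep_iSup_of_disjoint
    (m := fun p : ι × ℕ => MeasurableSpace.comap (η p.1 p.2) Real.measurableSpace)
    (fun p => (hmeas p.1 p.2).comap_le) hindep.iIndep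
    (Set.disjoint_left.2 fun p hi hj => hij (hi.symm.trans hj))

end Concentration

/-! ### Dyadic control of the path and of the area -/

section DyadicControl

variable {H ε b R : ℝ} {z w : ℕ → ℝ} {s t : ℝ}

/-- Every dyadic increment of the path driven by `z`, on an interval of length `h`, is at most
`R h ^ b`. -/
def DyadicPathBound (H ε b R : ℝ) (z : ℕ → ℝ) : Prop :=
  ∀ n k : ℕ, k < 2 ^ n → |noisePath H ε z ((k + 1) / 2 ^ n) - noisePath H ε z (k / 2 ^ n)| ≤
    R * ((1 / 2) ^ b) ^ n

/-- Every dyadic increment of the area driven by `z` and `w`, on an interval of length `h`, is at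
most `R² h ^ (2 b)`. -/
def DyadicAreaBound (H ε b R : ℝ) (z w : ℕ → ℝ) : Prop :=
  ∀ n k : ℕ, k < 2 ^ n → |noiseArea H ε z w (k / 2 ^ n) ((k + 1) / 2 ^ n)| ≤
    R ^ 2 * ((1 / 2) ^ (2 * b)) ^ n

theorem dyadic_mem_Icc {n k : ℕ} (hk : k < 2 ^ n) :
    (0 : ℝ) ≤ k / 2 ^ n ∧ (k : ℝ) / 2 ^ n ≤ (k + 1) / 2 ^ n ∧ ((k : ℝ) + 1) / 2 ^ n ≤ 1 := by
  refine ⟨by positivity, by gcongr; linarith, ?_⟩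
  rw [div_le_one (by positivity)]
  exact_mod_cast hk

theorem dyadic_length (n k : ℕ) : ((k : ℝ) + 1) / 2 ^ n - k / 2 ^ n = (1 / 2) ^ n := by
  rw [← sub_div, add_sub_cancel_left, one_div_pow]

theorem DyadicPathBound.holder (h : DyadicPathBound H ε b R z) (hH : H < 1 / 2) (hε : 0 < ε)
    (hb : 0 < b) (hR : 0 ≤ R) (hs : 0 ≤ s) (hst : s ≤ t) (ht : t ≤ 1) :
    |noisePath H ε z t - noisePath H ε z s| ≤ chainConst b * R * (t - s) ^ b := by
  have := abs_le_of_dyadic (A := fun s t => noisePath H ε z t - noisePath H ε z s) (L := 0)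
    (Λ := speedBound H ε z) hb hR le_rfl h (fun s u t _ _ _ _ => by simp)
    (fun s t hs hst ht => by
      have h1 := abs_noisePath_sub_le (z := z) hH hε (s := s) (t := t) ⟨hs, hst.trans ht⟩
        ⟨hs.trans hst, ht⟩
      rwa [abs_of_nonneg (sub_nonneg.2 hst)] at h1) hs hst ht
  simpa using this

/-- Chen's relation and the Hölder bounds of the paths make the area almost additive, so that it
can be chained. -/
theorem DyadicAreaBound.holder (h : DyadicAreaBound H ε b R z w) (hz : DyadicPathBound H ε b R z)
    (hw : DyadicPathBound H ε b R w) (hH : H < 1 / 2) (hε : 0 < ε)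
    (hb : 0 < b) (hR : 0 ≤ R) (hs : 0 ≤ s) (hst : s ≤ t) (ht : t ≤ 1) :
    |noiseArea H ε z w s t| ≤
      chainConst (2 * b) * (R ^ 2 + (chainConst b * R) ^ 2) * (t - s) ^ (2 * b) := by
  refine abs_le_of_dyadic (A := noiseArea H ε z w) (Λ := speedBound H ε w * speedBound H ε z)
    (by positivity) (by positivity) (by positivity) h (fun s u t hs hsu hut ht => ?_)
    (fun s t hs hst ht => ?_) hs hst ht
  · rw [noiseArea_chen hH hε ⟨hs, hsu.trans (hut.trans ht)⟩ ⟨hs.trans hsu, hut.trans ht⟩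
      ⟨hs.trans (hsu.trans hut), ht⟩, abs_mul]
    have hK : 0 ≤ chainConst b * R := mul_nonneg (chainConst_pos hb).le hR
    have h0 : 0 ≤ t - s := by linarith
    calc |noisePath H ε w u - noisePath H ε w s| * |noisePath H ε z t - noisePath H ε z u|
        ≤ (chainConst b * R * (u - s) ^ b) * (chainConst b * R * (t - u) ^ b) :=
          mul_le_mul (hw.holder hH hε hb hR hs hsu (hut.trans ht))
            (hz.holder hH hε hb hR (hs.trans hsu) hut ht) (abs_nonneg _)
            (mul_nonneg hK (Real.rpow_nonneg (sub_nonneg.2 hsu) _))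
      _ ≤ (chainConst b * R * (t - s) ^ b) * (chainConst b * R * (t - s) ^ b) := by
          have h1 : 0 ≤ u - s := by linarith
          have h2 : 0 ≤ t - u := by linarith
          gcongr
      _ = (chainConst b * R) ^ 2 * (t - s) ^ (2 * b) := by
          rw [two_mul b, Real.rpow_add_of_nonneg h0 hb.le hb.le]; ring
  · have h1 := abs_noiseArea_le (z := z) (w := w) hH hε (s := s) (t := t) ⟨hs, hst.trans ht⟩
      ⟨hs.trans hst, ht⟩
    rwa [abs_of_nonneg (sub_nonneg.2 hst)] at h1

theorem measurable_noisePath (hH : H < 1 / 2) (hε : 0 < ε) (ht : t ∈ Icc (0 : ℝ) 1) :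
    Measurable fun z => noisePath H ε z t := by
  have h : (fun z => noisePath H ε z t) = fun z =>
      ∑ k ∈ Finset.range (cellCount ε), z k * noisePath H ε (Pi.single k 1) t :=
    funext fun z => noisePath_eq_sum hH hε ht
  rw [h]
  fun_prop

theorem measurable_noiseArea (hH : H < 1 / 2) (hε : 0 < ε) (hs : s ∈ Icc (0 : ℝ) 1)
    (ht : t ∈ Icc (0 : ℝ) 1) :
    Measurable fun p : (ℕ → ℝ) × (ℕ → ℝ) => noiseArea H ε p.1 p.2 s t := by
  have h : (fun p : (ℕ → ℝ) × (ℕ → ℝ) => noiseArea H ε p.1 p.2 s t) = fun p =>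
      ∑ k ∈ Finset.range (cellCount ε), ∑ l ∈ Finset.range (cellCount ε),
        p.1 k * p.2 l * noiseArea H ε (Pi.single k 1) (Pi.single l 1) s t :=
    funext fun p => noiseArea_eq_sum hH hε hs ht
  rw [h]
  fun_prop

theorem measurableSet_dyadicPathBound (hH : H < 1 / 2) (hε : 0 < ε) :
    MeasurableSet {z | DyadicPathBound H ε b R z} := by
  simp only [DyadicPathBound, ofPred_forall]
  refine MeasurableSet.iInter fun n => MeasurableSet.iInter fun k => MeasurableSet.iInter fun hk => ?_
  obtain ⟨h0, h1, h2⟩ := dyadic_mem_Icc hk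
  exact measurableSet_le ((measurable_noisePath hH hε ⟨h0.trans h1, h2⟩).sub
    (measurable_noisePath hH hε ⟨h0, h1.trans h2⟩)).abs measurable_const

/-- Dyadic scales: `h ^ (2H)` is a small fraction of `(h ^ b)²`. -/
theorem dyadic_variance_eq (H b : ℝ) (n : ℕ) :
    ((1 / 2 : ℝ) ^ n) ^ (2 * H) = ((1 / 2) ^ (2 * (H - b))) ^ n * (((1 / 2) ^ b) ^ n) ^ 2 := by
  rw [one_half_pow_rpow, ← pow_mul, mul_comm n 2, pow_mul, ← mul_pow]
  congr 1
  rw [← Real.rpow_natCast, ← Real.rpow_mul (by norm_num), ← Real.rpow_add (by norm_num)]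
  congr 1
  push_cast
  ring

theorem scale_pow_le {m : ℕ} (hm : 1 ≤ m * (H - b)) :
    ((1 / 2 : ℝ) ^ (2 * (H - b))) ^ m ≤ 1 / 4 := by
  rw [← Real.rpow_natCast, ← Real.rpow_mul (by norm_num)]
  calc (1 / 2 : ℝ) ^ (2 * (H - b) * m) ≤ (1 / 2) ^ (2 : ℝ) :=
        Real.rpow_le_rpow_of_exponent_ge (by norm_num) (by norm_num) (by linarith)
    _ = 1 / 4 := by norm_num

end DyadicControl

section GoodEvents

variable {Ω : Type*} [MeasurableSpace Ω] {P : Measure Ω} {H ε b R : ℝ} {c : NNReal}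

/-- A bound for `4 ^ n` times the probability that a dyadic control at level `R` fails on a given
interval of length `2 ^ (-n)`. -/
def failureBound (G : ℝ) (m : ℕ) (R : ℝ) : ℝ := 2 * (m.factorial * (2 * (G / R ^ 2)) ^ m)

theorem failureBound_nonneg {G : ℝ} (hG : 0 ≤ G) (m : ℕ) : 0 ≤ failureBound G m R := by
  unfold failureBound; positivity

/-- The tail of a linear form whose variance is a small fraction of the squared threshold. -/
theorem measure_le_abs_sum_dyadic {X : ℕ → Ω → ℝ} (hind : iIndepFun X P)
    (hX : ∀ k, HasSubgaussianMGF (X k) c P) (N : ℕ) (a : ℕ → ℝ) {G x : ℝ} (hG : 0 < G)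
    (hR : 0 < R) (hx : 0 < x) {n m : ℕ} (hm : 1 ≤ m * (H - b))
    (ha : c * ∑ k ∈ Finset.range N, a k ^ 2 ≤
      G / R ^ 2 * ((1 / 2) ^ (2 * (H - b))) ^ n * x ^ 2) :
    P {ω | x ≤ |∑ k ∈ Finset.range N, X k ω * a k|} ≤
      ENNReal.ofReal (failureBound G m R * (1 / 4) ^ n) := by
  refine (measure_le_abs_sum hind hX N a (by positivity) hx ha m).trans
    (ENNReal.ofReal_le_ofReal ?_)
  have h1 : (2 * (G / R ^ 2 * ((1 / 2 : ℝ) ^ (2 * (H - b))) ^ n)) ^ m =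
      (2 * (G / R ^ 2)) ^ m * (((1 / 2 : ℝ) ^ (2 * (H - b))) ^ m) ^ n := by
    rw [← mul_assoc, mul_pow, ← pow_mul, mul_comm n m, pow_mul]
  rw [h1, failureBound, mul_assoc 2, mul_assoc (m.factorial : ℝ)]
  have h2 := scale_pow_le hm
  gcongr

/-- An increment of the path is the integral of the constant `1`, with variance of order
`h ^ (2H)`. -/
theorem measure_not_dyadicPathBound_le {X : ℕ → Ω → ℝ} (hind : iIndepFun X P)
    (hX : ∀ k, HasSubgaussianMGF (X k) c P) (hH0 : 0 < H) (hH : H < 1 / 2) (hε : 0 < ε)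
    (hb0 : 0 < b) (hb : 0 < b + (H - 1 / 2)) (hR : 0 < R) {G : ℝ} (hG : 0 < G) (hcG : c / H ≤ G)
    {m : ℕ} (hm : 1 ≤ m * (H - b)) :
    P {ω | ¬ DyadicPathBound H ε b R fun k => X k ω} ≤
      ENNReal.ofReal (2 * failureBound G m R) := by
  refine le_trans (measure_mono ?_) (measure_dyadic_union_le
    (fun n k => {ω | R * ((1 / 2) ^ b) ^ n ≤
      |noisePath H ε (fun l => X l ω) ((k + 1) / 2 ^ n) -
        noisePath H ε (fun l => X l ω) (k / 2 ^ n)|})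
    (failureBound_nonneg hG.le m) fun n k hk => ?_)
  · intro ω (hω : ¬ DyadicPathBound H ε b R fun k => X k ω)
    unfold DyadicPathBound at hω
    push Not at hω
    obtain ⟨n, k, hk, h⟩ := hω
    exact ⟨n, k, hk, h.le⟩
  · obtain ⟨h0, h1, h2⟩ := dyadic_mem_Icc hk
    simp_rw [noisePath_sub_eq_sum hH hε h0 h1 h2]
    refine measure_le_abs_sum_dyadic hind hX _ _ hG hR (by positivity) hm ?_
    have h3 := sum_pathCoeff_sq_le (f := fun _ => 1) (F := 1) (M := 0) hH0 hH hε hb0 hb h0 h1 h2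
      continuousOn_const le_rfl (fun u _ => by simp) (fun r _ u _ _ => by simp)
    rw [dyadic_length, zero_mul, zero_mul, add_zero, one_pow, one_mul, dyadic_variance_eq H b] at h3
    calc (c : ℝ) * ∑ l ∈ Finset.range (cellCount ε), _ ^ 2
        ≤ c * (((1 / 2) ^ (2 * (H - b))) ^ n * (((1 / 2) ^ b) ^ n) ^ 2 / H) :=
          mul_le_mul_of_nonneg_left h3 c.2
      _ = c / H * (((1 / 2) ^ (2 * (H - b))) ^ n * (((1 / 2) ^ b) ^ n) ^ 2) := by ring
      _ ≤ G * (((1 / 2) ^ (2 * (H - b))) ^ n * (((1 / 2) ^ b) ^ n) ^ 2) := by gcongr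
      _ = _ := by field_simp

/-- Conditionally on the row `Y`, the area is a linear form in the independent row `X`, and the
Hölder bound for the path of `Y` bounds its variance by a multiple of `R² h ^ (2b + 2H)`. -/
theorem measure_not_dyadicAreaBound_le {X Y : ℕ → Ω → ℝ} (hind : iIndepFun X P)
    (hX : ∀ k, HasSubgaussianMGF (X k) c P) (hXm : ∀ k, Measurable (X k))
    (hYm : ∀ k, Measurable (Y k)) (hXY : IndepFun (fun ω k => X k ω) (fun ω k => Y k ω) P)
    (hH0 : 0 < H) (hH : H < 1 / 2) (hε : 0 < ε)
    (hb0 : 0 < b) (hb : 0 < b + (H - 1 / 2)) (hR : 0 < R) {G : ℝ} (hG : 0 < G)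
    (hcG : c * (chainConst b * (1 + |H - 1 / 2| / (b + (H - 1 / 2)))) ^ 2 / H ≤ G)
    {m : ℕ} (hm : 1 ≤ m * (H - b)) :
    P {ω | DyadicPathBound H ε b R (fun k => Y k ω) ∧
        ¬ DyadicAreaBound H ε b R (fun k => X k ω) fun k => Y k ω} ≤
      ENNReal.ofReal (2 * failureBound G m R) := by
  have : IsProbabilityMeasure P := hind.isProbabilityMeasure
  refine le_trans (measure_mono ?_) (measure_dyadic_union_le
    (fun n k => {ω | ((fun l => X l ω), fun l => Y l ω) ∈ {p : (ℕ → ℝ) × (ℕ → ℝ) |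
      DyadicPathBound H ε b R p.2 ∧ R ^ 2 * ((1 / 2) ^ (2 * b)) ^ n ≤
        |noiseArea H ε p.1 p.2 (k / 2 ^ n) ((k + 1) / 2 ^ n)|}})
    (failureBound_nonneg hG.le m) fun n k hk => ?_)
  · intro ω ⟨hw, hω⟩
    unfold DyadicAreaBound at hω
    push Not at hω
    obtain ⟨n, k, hk, h⟩ := hω
    exact ⟨n, k, hk, hw, h.le⟩
  obtain ⟨h0, h1, h2⟩ := dyadic_mem_Icc hk
  refine measure_pair_mem_le_of_indepFun (measurable_pi_lambda _ hXm) (measurable_pi_lambda _ hYm)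
    hXY (((measurableSet_dyadicPathBound hH hε).preimage measurable_snd).inter
      (measurableSet_le measurable_const
        (measurable_noiseArea hH hε ⟨h0, h1.trans h2⟩ ⟨h0.trans h1, h2⟩).abs)) fun w => ?_
  -- the control of the path of `Y` belongs to the event, so other values `w` contribute nothing
  by_cases hw : DyadicPathBound H ε b R w
  swap
  · refine le_of_eq_of_le (measure_mono_null ?_ measure_empty) zero_le
    exact fun ω hω => hw hω.1
  refine (measure_mono fun ω hω => hω.2).trans (?_ : P {ω | R ^ 2 * ((1 / 2) ^ (2 * b)) ^ n ≤
    |noiseArea H ε (fun l => X l ω) w (k / 2 ^ n) ((k + 1) / 2 ^ n)|} ≤ _)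
  simp_rw [noiseArea_eq_sum_pathCoeff hH hε h0 h1 h2]
  refine measure_le_abs_sum_dyadic hind hX _ _ hG hR (by positivity) hm ?_
  set M := chainConst b * R with hMdef
  have hM : 0 ≤ M := mul_nonneg (chainConst_pos hb0).le hR.le
  have hsubset := Icc_subset_Icc h0 h2
  have h3 := sum_pathCoeff_sq_le
    (f := fun r => noisePath H ε w r - noisePath H ε w (k / 2 ^ n))
    (F := M * (((k : ℝ) + 1) / 2 ^ n - k / 2 ^ n) ^ b) (M := M) hH0 hH hε hb0 hb h0 h1 h2
    (((continuousOn_noisePath hH hε).mono hsubset).sub continuousOn_const) hM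
    (fun u hu => (hw.holder hH hε hb0 hR.le h0 hu.1 (hu.2.trans h2)).trans
      (mul_le_mul_of_nonneg_left (Real.rpow_le_rpow (by linarith [hu.1]) (by linarith [hu.2])
        hb0.le) hM))
    (fun r hr u hu hru => by
      have := hw.holder hH hε hb0 hR.le (h0.trans hr.1) hru (hu.2.trans h2)
      simpa using this)
  rw [dyadic_length, dyadic_variance_eq H b, one_half_pow_rpow] at h3
  calc (c : ℝ) * ∑ l ∈ Finset.range (cellCount ε), _ ^ 2 ≤ c * _ :=
        mul_le_mul_of_nonneg_left h3 c.2
    _ = c * (chainConst b * (1 + |H - 1 / 2| / (b + (H - 1 / 2)))) ^ 2 / H *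
        (((1 / 2) ^ (2 * (H - b))) ^ n * ((((1 / 2) ^ b) ^ n) ^ 2) ^ 2 * R ^ 2) := by
        rw [hMdef]; ring
    _ ≤ G * (((1 / 2) ^ (2 * (H - b))) ^ n * ((((1 / 2) ^ b) ^ n) ^ 2) ^ 2 * R ^ 2) := by gcongr
    _ = _ := by
        have h4 : ((1 / 2 : ℝ) ^ (2 * b)) ^ n = (((1 / 2) ^ b) ^ n) ^ 2 := by
          rw [mul_comm 2 b, Real.rpow_mul (by norm_num), ← pow_mul, mul_comm n 2, pow_mul]
          norm_num
        rw [h4]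
        field_simp

end GoodEvents

/-! ### The lift of the driving sequences to the rough path space -/

section Lift

variable {V : Type*} [NormedAddCommGroup V] [NormedSpace ℝ V] {H ε μ : ℝ}

theorem exists_holderOne_noisePath (hμ : 0 < μ) (hμ1 : μ < 1) (hH : H < 1 / 2) (hε : 0 < ε)
    (z : ℕ → ℝ) (v : V) : ∃ x : HolderOne μ V, ∀ t : I, x.1 t = noisePath H ε z t • v := by
  have hc : Continuous fun t : I => noisePath H ε z t • v :=
    (continuousOn_noisePath hH hε).domRestrict.smul continuous_const
  refine ⟨⟨⟨_, hc⟩, mem_holderTwo_of_le (C := speedBound H ε z * ‖v‖) hμ hμ1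
    (mul_nonneg (speedBound_nonneg hH hε) (norm_nonneg v)) fun s t => ?_⟩, fun t => rfl⟩
  change ‖noisePath H ε z t • v - noisePath H ε z s • v‖ ≤ _
  rw [← sub_smul, norm_smul, Real.rpow_one, mul_right_comm]
  exact mul_le_mul_of_nonneg_right (abs_noisePath_sub_le hH hε s.2 t.2) (norm_nonneg v)

theorem exists_holderTwo_noiseArea (hμ : 0 < μ) (hμ1 : 2 * μ < 1) (hH : H < 1 / 2) (hε : 0 < ε)
    (z w : ℕ → ℝ) (v : V) :
    ∃ y : HolderTwo (2 * μ) V, ∀ s t : I, y.1 (s, t) = noiseArea H ε z w s t • v := by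
  have hc : Continuous fun p : I × I => noiseArea H ε z w p.1 p.2 • v := by
    have hx : ∀ z, Continuous fun t : I => noisePath H ε z t := fun z =>
      (continuousOn_noisePath hH hε).domRestrict
    have hy : Continuous fun t : I => noiseArea H ε z w 0 t :=
      (continuousOn_noiseArea_zero hH hε).domRestrict
    have h : (fun p : I × I => noiseArea H ε z w p.1 p.2) = fun p =>
        noiseArea H ε z w 0 p.2 - noiseArea H ε z w 0 p.1 -
          noisePath H ε w p.1 * (noisePath H ε z p.2 - noisePath H ε z p.1) :=
      funext fun p => noiseArea_eq hH hε p.1.2 p.2.2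
    refine Continuous.smul ?_ continuous_const
    rw [h]
    exact ((hy.comp continuous_snd).sub (hy.comp continuous_fst)).sub
      (((hx w).comp continuous_fst).mul
        (((hx z).comp continuous_snd).sub ((hx z).comp continuous_fst)))
  refine ⟨⟨⟨_, hc⟩, mem_holderTwo_of_le (C := speedBound H ε w * speedBound H ε z * ‖v‖)
    (by positivity) hμ1 (mul_nonneg (mul_nonneg (speedBound_nonneg hH hε)
      (speedBound_nonneg hH hε)) (norm_nonneg v)) fun s t => ?_⟩, fun s t => rfl⟩
  change ‖noiseArea H ε z w s t • v‖ ≤ _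
  rw [norm_smul, Real.rpow_one, mul_right_comm]
  exact mul_le_mul_of_nonneg_right (abs_noiseArea_le hH hε s.2 t.2) (norm_nonneg v)

/-- Evaluation of a path of `C₁^ν`. -/
def HolderOne.eval (t : I) : HolderOne μ V →ₗ[ℝ] V where
  toFun x := x.1 t
  map_add' _ _ := rfl
  map_smul' _ _ := rfl

/-- Evaluation of an element of `C₂^ν`. -/
def HolderTwo.eval (p : I × I) : HolderTwo μ V →ₗ[ℝ] V where
  toFun y := y.1 p
  map_add' _ _ := rfl
  map_smul' _ _ := rfl

/-- Only finitely many entries of the driving sequences matter, and the path and the area are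
polynomials in them with coefficients in the Hölder spaces. Measurability follows although these
spaces are not separable. -/
theorem exists_measurable_lift (d : ℕ) (hμ : 0 < μ) (hμ1 : 2 * μ < 1) (hH : H < 1 / 2)
    (hε : 0 < ε) :
    ∃ Φ : (Fin d → ℕ → ℝ) → RoughSpace d μ, Measurable Φ ∧ ∀ z,
      (∀ (t : I) (i : Fin d), (Φ z).1.1 t i = noisePath H ε (z i) t) ∧
      ∀ (s t : I) (i j : Fin d), (Φ z).2.1 (s, t) (i, j) = noiseArea H ε (z i) (z j) s t := by
  choose E hE using fun (i : Fin d) (k : ℕ) => exists_holderOne_noisePath hμ (by linarith) hH hε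
    (Pi.single k 1) (EuclideanSpace.single i (1 : ℝ))
  choose A hA using fun (i j : Fin d) (k l : ℕ) => exists_holderTwo_noiseArea hμ hμ1 hH hε
    (Pi.single k 1) (Pi.single l 1) (EuclideanSpace.single (i, j) (1 : ℝ))
  let N := Finset.range (cellCount ε)
  let Φ₁ : (Fin d → ℕ → ℝ) → HolderOne μ (EuclideanSpace ℝ (Fin d)) := fun z =>
    ∑ i, ∑ k ∈ N, z i k • E i k
  let Φ₂ : (Fin d → ℕ → ℝ) → HolderTwo (2 * μ) (EuclideanSpace ℝ (Fin d × Fin d)) := fun z =>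
    ∑ i, ∑ j, ∑ k ∈ N, ∑ l ∈ N, (z i k * z j l) • A i j k l
  have h1 : Continuous Φ₁ := by fun_prop
  have h2 : Continuous Φ₂ := by fun_prop
  have h12 : Continuous (Y := RoughSpace d μ) fun z => (Φ₁ z, Φ₂ z) := h1.prodMk h2
  refine ⟨_, h12.measurable, fun z => ⟨fun t i => ?_, fun s t i j => ?_⟩⟩
  · change (HolderOne.eval t (∑ i, ∑ k ∈ N, z i k • E i k)) i = _
    have h : ∀ i k, HolderOne.eval t (E i k) = _ := fun i k => hE i k t
    simp only [map_sum, map_smul, h, WithLp.ofLp_sum, WithLp.ofLp_smul, Finset.sum_apply,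
      Pi.smul_apply, PiLp.ofLp_single, smul_eq_mul]
    rw [Finset.sum_eq_single i (fun i' _ hi' => by simp [hi'.symm]) (by simp),
      noisePath_eq_sum hH hε t.2]
    simp [N]
  · change (HolderTwo.eval (s, t) (∑ i, ∑ j, ∑ k ∈ N, ∑ l ∈ N, (z i k * z j l) • A i j k l))
      (i, j) = _
    have h : ∀ i j k l, HolderTwo.eval (s, t) (A i j k l) = _ := fun i j k l => hA i j k l s t
    simp only [map_sum, map_smul, h, WithLp.ofLp_sum, WithLp.ofLp_smul, Finset.sum_apply,
      Pi.smul_apply, PiLp.ofLp_single, smul_eq_mul]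
    rw [Finset.sum_eq_single i (fun i' _ hi' => by simp [hi'.symm]) (by simp),
      Finset.sum_eq_single j (fun j' _ hj' => by simp [hj'.symm]) (by simp),
      noiseArea_eq_sum hH hε s.2 t.2]
    simp [N]

end Lift

/-! ### Identification with the approximating processes -/

section Identification

variable {Ω : Type*} {d : ℕ} {H ε : ℝ} {η : Fin d → ℕ → Ω → ℝ}

theorem donskerPath_eq_noisePath (hH : H < 1 / 2) (hε : 0 < ε) (ω : Ω) (i : Fin d) (t : I) :
    donskerPath H η ε ω i t = noisePath H ε (fun k => η i k ω) t :=
  donskerPath_eq_integral_velocity η ω i hH hε t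

theorem boundedVariationOn_donskerPath (hH : H < 1 / 2) (hε : 0 < ε) (ω : Ω) (i : Fin d) :
    BoundedVariationOn (donskerPath H η ε ω i) univ :=
  (lipschitzWith_of_density (c := 0) (fun _ hu => abs_velocity_le_speedBound hH hε hu.2)
    (integrableOn_velocity hH hε) fun t => by
      rw [zero_add]; exact donskerPath_eq_noisePath hH hε ω i t).boundedVariationOn_unitInterval

theorem donskerArea_eq_noiseArea (hH : H < 1 / 2) (hε : 0 < ε) (ω : Ω) (i j : Fin d) (s t : I) :
    donskerArea H η ε ω i j s t =
      noiseArea H ε (fun k => η i k ω) (fun k => η j k ω) s t := by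
  unfold donskerArea
  simp_rw [donskerPath_eq_noisePath hH hε ω j]
  exact stieltjesIntegral_eq_intervalIntegral (c := 0)
    (fun _ hu => abs_velocity_le_speedBound hH hε hu.2) measurable_velocity
    (integrableOn_velocity hH hε)
    (fun t => by rw [zero_add]; exact donskerPath_eq_noisePath hH hε ω i t)
    (f := fun u => noisePath H ε (fun k => η j k ω) u - noisePath H ε (fun k => η j k ω) s)
    ((continuousOn_noisePath hH hε).sub continuousOn_const) s t

end Identification

/-! ### From the dyadic control to the compact sets -/

section Compactness

variable {H ε b R : ℝ} {d : ℕ}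

/-- The event on which all paths and all areas of distinct components are controlled at level
`R`. -/
def GoodEvent (H ε b R : ℝ) (z : Fin d → ℕ → ℝ) : Prop :=
  (∀ i, DyadicPathBound H ε b R (z i)) ∧
    ∀ i j, i ≠ j → DyadicAreaBound H ε b R (z i) (z j)

/-- A common bound for the constants of all components at level `R`. -/
def levelConst (b R : ℝ) : ℝ :=
  chainConst b * R + chainConst (2 * b) * (R ^ 2 + (chainConst b * R) ^ 2) +
    2 * (chainConst b * R) ^ 2

theorem levelConst_nonneg (hb : 0 < b) (hR : 0 ≤ R) : 0 ≤ levelConst b R := by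
  have h1 := chainConst_pos hb
  have h2 := chainConst_pos (show 0 < 2 * b by positivity)
  unfold levelConst
  positivity

variable {z : Fin d → ℕ → ℝ}

theorem GoodEvent.abs_path_le (h : GoodEvent H ε b R z) (hH : H < 1 / 2) (hε : 0 < ε)
    (hb : 0 < b) (hR : 0 ≤ R) (i : Fin d) (s t : I) :
    |noisePath H ε (z i) t - noisePath H ε (z i) s| ≤
      chainConst b * R * |(t : ℝ) - s| ^ b := by
  rcases le_total (s : ℝ) t with hst | hst
  · rw [abs_of_nonneg (sub_nonneg.2 hst)]
    exact (h.1 i).holder hH hε hb hR s.2.1 hst t.2.2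
  · rw [abs_sub_comm, abs_sub_comm (t : ℝ), abs_of_nonneg (sub_nonneg.2 hst)]
    exact (h.1 i).holder hH hε hb hR t.2.1 hst s.2.2

theorem GoodEvent.abs_path_mul_le (h : GoodEvent H ε b R z) (hH : H < 1 / 2) (hε : 0 < ε)
    (hb : 0 < b) (hR : 0 ≤ R) (i j : Fin d) (s u t : I) :
    |(noisePath H ε (z j) u - noisePath H ε (z j) s) *
      (noisePath H ε (z i) t - noisePath H ε (z i) u)| ≤
      (chainConst b * R) ^ 2 * (|(u : ℝ) - s| ^ b * |(t : ℝ) - u| ^ b) := by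
  have hK : 0 ≤ chainConst b * R := mul_nonneg (chainConst_pos hb).le hR
  rw [abs_mul]
  refine (mul_le_mul (h.abs_path_le hH hε hb hR j s u) (h.abs_path_le hH hε hb hR i u t)
    (abs_nonneg _) (by positivity)).trans_eq (by ring)

/-- The diagonal areas are controlled by the path alone, and the areas with reversed arguments
by Chen's relation. -/
theorem GoodEvent.abs_area_le (h : GoodEvent H ε b R z) (hH : H < 1 / 2) (hε : 0 < ε)
    (hb : 0 < b) (hR : 0 ≤ R) (i j : Fin d) (s t : I) :
    |noiseArea H ε (z i) (z j) s t| ≤ levelConst b R * |(t : ℝ) - s| ^ (2 * b) := by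
  have hK : 0 ≤ chainConst b * R := mul_nonneg (chainConst_pos hb).le hR
  have hK2 : 0 ≤ chainConst (2 * b) := (chainConst_pos (by positivity)).le
  have hsq : ∀ s t : I, |(t : ℝ) - s| ^ b * |(t : ℝ) - s| ^ b = |(t : ℝ) - s| ^ (2 * b) :=
    fun s t => by rw [two_mul, Real.rpow_add_of_nonneg (abs_nonneg _) hb.le hb.le]
  have key : ∀ s t : I, (s : ℝ) ≤ t → |noiseArea H ε (z i) (z j) s t| ≤
      (chainConst (2 * b) * (R ^ 2 + (chainConst b * R) ^ 2) + (chainConst b * R) ^ 2) *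
        |(t : ℝ) - s| ^ (2 * b) := by
    intro s t hst
    by_cases hij : i = j
    · subst hij
      have h1 := h.abs_path_le hH hε hb hR i s t
      have h2 : (noisePath H ε (z i) t - noisePath H ε (z i) s) ^ 2 ≤
          (chainConst b * R) ^ 2 * |(t : ℝ) - s| ^ (2 * b) := by
        rw [← hsq, ← sq, ← mul_pow]
        exact sq_le_sq' (abs_le.1 h1).1 (abs_le.1 h1).2
      have h3 : 0 ≤ chainConst (2 * b) * (R ^ 2 + (chainConst b * R) ^ 2) *
        |(t : ℝ) - s| ^ (2 * b) := by positivity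
      rw [noiseArea_diag hH hε s.2 t.2, abs_of_nonneg (by positivity)]
      linarith [sq_nonneg (noisePath H ε (z i) t - noisePath H ε (z i) s)]
    · have h1 := (h.2 i j hij).holder (h.1 i) (h.1 j) hH hε hb hR s.2.1 hst t.2.2
      have h2 : 0 ≤ (chainConst b * R) ^ 2 * (t - s : ℝ) ^ (2 * b) :=
        mul_nonneg (sq_nonneg _) (Real.rpow_nonneg (sub_nonneg.2 hst) _)
      rw [abs_of_nonneg (sub_nonneg.2 hst)]
      linarith
  have hpow : 0 ≤ |(t : ℝ) - s| ^ (2 * b) := by positivity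
  have hKp : 0 ≤ chainConst b * R * |(t : ℝ) - s| ^ (2 * b) := by positivity
  have hKp' : 0 ≤ (chainConst b * R) ^ 2 * |(t : ℝ) - s| ^ (2 * b) := by positivity
  unfold levelConst
  rcases le_total (s : ℝ) t with hst | hst
  · linarith [key s t hst]
  · have h1 := key t s hst
    have h2 := h.abs_path_mul_le hH hε hb hR i j s t s
    have h3 := noiseArea_chen (z := z i) (w := z j) hH hε s.2 t.2 s.2
    rw [← h3, noiseArea_self, zero_sub, abs_sub_comm (s : ℝ), hsq] at h2
    rw [abs_sub_comm (s : ℝ)] at h1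
    have h4 := abs_add_le (-noiseArea H ε (z i) (z j) s t - noiseArea H ε (z i) (z j) t s)
      (noiseArea H ε (z i) (z j) t s)
    rw [sub_add_cancel, abs_neg] at h4
    linarith

theorem euclideanSpace_norm_le_of_forall {ι : Type*} [Fintype ι] (x : EuclideanSpace ℝ ι) {B : ℝ}
    (h : ∀ i, |x i| ≤ B) : ‖x‖ ≤ Fintype.card ι * B := by
  classical
  have h1 : x = ∑ i, x i • EuclideanSpace.single i (1 : ℝ) := by
    ext j
    simp [Pi.single_apply]
  rw [h1]
  refine (norm_sum_le _ _).trans ?_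
  calc ∑ i, ‖x i • EuclideanSpace.single i (1 : ℝ)‖ ≤ ∑ _i : ι, B :=
        Finset.sum_le_sum fun i _ => by simpa [norm_smul] using h i
    _ = Fintype.card ι * B := by simp

theorem GoodEvent.mem_pathBall (h : GoodEvent H ε b R z) (hH : H < 1 / 2) (hε : 0 < ε)
    (hb : 0 < b) (hR : 0 ≤ R) {x : I → EuclideanSpace ℝ (Fin d)}
    (hx : ∀ t i, x t i = noisePath H ε (z i) t) :
    x ∈ pathBall (EuclideanSpace ℝ (Fin d)) (d * levelConst b R) b := by
  have hK2 : 0 ≤ chainConst (2 * b) := (chainConst_pos (by positivity)).le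
  have hle : chainConst b * R ≤ levelConst b R := by
    unfold levelConst
    have : 0 ≤ chainConst (2 * b) * (R ^ 2 + (chainConst b * R) ^ 2) := by positivity
    linarith [sq_nonneg (chainConst b * R)]
  refine ⟨?_, fun s t => ?_⟩
  · ext i
    rw [hx]
    exact noisePath_zero
  · refine (euclideanSpace_norm_le_of_forall _ (B := levelConst b R * |(t : ℝ) - s| ^ b)
      fun i => ?_).trans_eq (by rw [Fintype.card_fin, mul_assoc])
    rw [PiLp.sub_apply, hx, hx]
    exact (h.abs_path_le hH hε hb hR i s t).trans (by gcongr)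

theorem GoodEvent.mem_areaBall (h : GoodEvent H ε b R z) (hH : H < 1 / 2) (hε : 0 < ε)
    (hb : 0 < b) (hR : 0 ≤ R) {y : I × I → EuclideanSpace ℝ (Fin d × Fin d)}
    (hy : ∀ s t i j, y (s, t) (i, j) = noiseArea H ε (z i) (z j) s t) :
    y ∈ areaBall (EuclideanSpace ℝ (Fin d × Fin d)) ((d * d) * levelConst b R) b := by
  have hK : 0 ≤ chainConst b * R := mul_nonneg (chainConst_pos hb).le hR
  have hK2 : 0 ≤ chainConst (2 * b) := (chainConst_pos (by positivity)).le
  have hle : (chainConst b * R) ^ 2 ≤ levelConst b R := by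
    unfold levelConst
    have : 0 ≤ chainConst (2 * b) * (R ^ 2 + (chainConst b * R) ^ 2) := by positivity
    linarith [sq_nonneg (chainConst b * R)]
  refine ⟨fun s t => ?_, fun s u t => ?_⟩
  · refine (euclideanSpace_norm_le_of_forall _ (B := levelConst b R * |(t : ℝ) - s| ^ (2 * b))
      fun p => ?_).trans_eq (by simp [mul_assoc])
    rw [hy]
    exact h.abs_area_le hH hε hb hR _ _ s t
  · refine (euclideanSpace_norm_le_of_forall _
      (B := levelConst b R * (|(u : ℝ) - s| ^ b * |(t : ℝ) - u| ^ b))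
      fun p => ?_).trans_eq (by simp [mul_assoc])
    rw [PiLp.sub_apply, PiLp.sub_apply, hy, hy, hy, noiseArea_chen hH hε s.2 u.2 t.2]
    exact (h.abs_path_mul_le hH hε hb hR _ _ s u t).trans (by gcongr)

end Compactness

/-! ### Tightness -/

section Tightness

theorem measure_not_goodEvent_le {Ω : Type*} [MeasurableSpace Ω] {P : Measure Ω} {H ε b R : ℝ}
    {c : NNReal} {d : ℕ} {η : Fin d → ℕ → Ω → ℝ}
    (hmeas : ∀ i k, Measurable (η i k)) (hindep : iIndepFun (fun p : Fin d × ℕ => η p.1 p.2) P)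
    (hη : ∀ i k, HasSubgaussianMGF (η i k) c P) (hH0 : 0 < H) (hH : H < 1 / 2) (hε : 0 < ε)
    (hb0 : 0 < b) (hb : 0 < b + (H - 1 / 2)) (hR : 0 < R) {G : ℝ} (hG : 0 < G) (hcG : c / H ≤ G)
    (hcG' : c * (chainConst b * (1 + |H - 1 / 2| / (b + (H - 1 / 2)))) ^ 2 / H ≤ G)
    {m : ℕ} (hm : 1 ≤ m * (H - b)) :
    P {ω | ¬ GoodEvent H ε b R fun i k => η i k ω} ≤
      ENNReal.ofReal ((d + d * d) * (2 * failureBound G m R)) := by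
  have hrow : ∀ i, iIndepFun (η i) P := fun i =>
    hindep.precomp (g := fun k : ℕ => (i, k)) fun k l h => congrArg Prod.snd h
  have hF : 0 ≤ failureBound G m R := failureBound_nonneg hG.le m
  have hsub : {ω | ¬ GoodEvent H ε b R fun i k => η i k ω} ⊆
      (⋃ i, {ω | ¬ DyadicPathBound H ε b R fun k => η i k ω}) ∪
        ⋃ i, ⋃ j, {ω | i ≠ j ∧ DyadicPathBound H ε b R (fun k => η j k ω) ∧
          ¬ DyadicAreaBound H ε b R (fun k => η i k ω) fun k => η j k ω} := by
    intro ω (hω : ¬ GoodEvent H ε b R fun i k => η i k ω)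
    by_contra hcon
    simp only [mem_union, mem_iUnion, not_or, not_exists, mem_ofPred_eq, not_not, not_and] at hcon
    exact hω ⟨hcon.1, fun i j hij => hcon.2 i j hij (hcon.1 j)⟩
  have harea : ∀ i j, P {ω | i ≠ j ∧ DyadicPathBound H ε b R (fun k => η j k ω) ∧
      ¬ DyadicAreaBound H ε b R (fun k => η i k ω) fun k => η j k ω} ≤
        ENNReal.ofReal (2 * failureBound G m R) := by
    intro i j
    by_cases hij : i = j
    · simp [hij]
    · exact (measure_mono fun ω hω => hω.2).trans (measure_not_dyadicAreaBound_le (hrow i) (hη i)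
        (hmeas i) (hmeas j) (indepFun_rows hmeas hindep hij) hH0 hH hε hb0 hb hR hG hcG' hm)
  calc P {ω | ¬ GoodEvent H ε b R fun i k => η i k ω}
      ≤ (∑ _i : Fin d, ENNReal.ofReal (2 * failureBound G m R)) +
        ∑ _i : Fin d, ∑ _j : Fin d, ENNReal.ofReal (2 * failureBound G m R) := by
        refine (measure_mono hsub).trans ((measure_union_le _ _).trans (add_le_add ?_ ?_))
        · exact (measure_iUnion_fintype_le _ _).trans (Finset.sum_le_sum fun i _ =>
            measure_not_dyadicPathBound_le (hrow i) (hη i) hH0 hH hε hb0 hb hR hG hcG hm)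
        · exact (measure_iUnion_fintype_le _ _).trans (Finset.sum_le_sum fun i _ =>
            (measure_iUnion_fintype_le _ _).trans (Finset.sum_le_sum fun j _ => harea i j))
    _ = ENNReal.ofReal ((d + d * d) * (2 * failureBound G m R)) := by
        rw [add_mul, ENNReal.ofReal_add (by positivity) (by positivity), mul_assoc,
          ENNReal.ofReal_mul (by positivity), ENNReal.ofReal_mul (by positivity),
          ENNReal.ofReal_mul (by positivity : (0 : ℝ) ≤ d), ENNReal.ofReal_natCast]
        simp

theorem tendsto_failureBound (G : ℝ) {m : ℕ} (hm : m ≠ 0) :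
    Filter.Tendsto (failureBound G m) Filter.atTop (nhds 0) := by
  have h1 : Filter.Tendsto (fun R : ℝ => G / R ^ 2) Filter.atTop (nhds 0) :=
    Filter.Tendsto.const_div_atTop (Filter.tendsto_pow_atTop two_ne_zero) G
  have h2 := (((h1.const_mul 2).pow m).const_mul (m.factorial : ℝ)).const_mul 2
  rw [mul_zero, zero_pow hm, mul_zero, mul_zero] at h2
  exact h2

/-- The compact subset of the rough path space which carries the good event at level `R`. -/
def levelSet (d : ℕ) (μ b R : ℝ) : Set (RoughSpace d μ) :=
  {x : HolderOne μ (EuclideanSpace ℝ (Fin d)) |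
      ⇑x.1 ∈ pathBall (EuclideanSpace ℝ (Fin d)) (d * levelConst b R) b} ×ˢ
    {y : HolderTwo (2 * μ) (EuclideanSpace ℝ (Fin d × Fin d)) |
      ⇑y.1 ∈ areaBall (EuclideanSpace ℝ (Fin d × Fin d)) ((d * d) * levelConst b R) b}

theorem isCompact_levelSet {d : ℕ} {μ b R : ℝ} (hμ : 0 < μ) (hμb : μ < b) (hR : 0 ≤ R) :
    IsCompact (levelSet d μ b R) := by
  have hL := levelConst_nonneg (hμ.trans hμb) hR
  exact (isCompact_holderOne hμ hμb (by positivity)).prod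
    (isCompact_holderTwo hμ hμb (by positivity))

end Tightness

end

theorem proposition2p4
    {Ω : Type*} [MeasurableSpace Ω] (P : Measure Ω) [IsProbabilityMeasure P]
    {Ω' : Type*} [MeasurableSpace Ω'] (P' : Measure Ω') [IsProbabilityMeasure P']
    (d : ℕ) (H μ kη : ℝ) (hH : 1 / 3 < H) (hH' : H < 1 / 2) (hμ : 0 < μ) (hμH : μ < H)
    (ξ : Ω' → ℝ) (hmean : ∫ ω, ξ ω ∂P' = 0) (hvar : ∫ ω, ξ ω ^ 2 ∂P' = 1)
    (hbdd : ∀ᵐ ω ∂P', |ξ ω| ≤ kη)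
    (η : Fin d → ℕ → Ω → ℝ) (hmeas : ∀ i k, Measurable (η i k))
    (hindep : iIndepFun (fun p : Fin d × ℕ => η p.1 p.2) P)
    (hlaw : ∀ i k, IdentDistrib (η i k) ξ P P') :
    (∀ ε : ℝ, 0 < ε → ∀ ω i, BoundedVariationOn (donskerPath H η ε ω i) univ) ∧
    ∃ Z : ℝ → Ω → RoughSpace d μ,
      (∀ ε : ℝ, 0 < ε → ∀ ω,
        (∀ (t : I) (i : Fin d), (Z ε ω).1.1 t i = donskerPath H η ε ω i t) ∧
        (∀ (s t : I) (i j : Fin d), (Z ε ω).2.1 (s, t) (i, j) = donskerArea H η ε ω i j s t)) ∧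
      (∀ ε : ℝ, 0 < ε → Measurable (Z ε)) ∧
      IsTightMeasureSet {m : Measure (RoughSpace d μ) | ∃ ε : ℝ, 0 < ε ∧ m = P.map (Z ε)} := by
  refine ⟨fun ε hε ω i => boundedVariationOn_donskerPath hH' hε ω i, ?_⟩
  have hH0 : 0 < H := by linarith
  have hΦ : ∀ ε : ℝ, ∃ Φ : (Fin d → ℕ → ℝ) → RoughSpace d μ, 0 < ε → (Measurable Φ ∧ ∀ z,
      (∀ (t : I) (i : Fin d), (Φ z).1.1 t i = noisePath H ε (z i) t) ∧
      ∀ (s t : I) (i j : Fin d), (Φ z).2.1 (s, t) (i, j) = noiseArea H ε (z i) (z j) s t) := by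
    intro ε
    by_cases hε : 0 < ε
    · obtain ⟨Φ, h⟩ := exists_measurable_lift d hμ (by linarith) hH' hε
      exact ⟨Φ, fun _ => h⟩
    · exact ⟨0, fun h => absurd h hε⟩
  choose Φ hΦ using hΦ
  have hηm : Measurable fun ω (i : Fin d) (k : ℕ) => η i k ω :=
    measurable_pi_lambda _ fun i => measurable_pi_lambda _ fun k => hmeas i k
  have hZm : ∀ ε : ℝ, 0 < ε → Measurable fun ω => Φ ε fun i k => η i k ω :=
    fun ε hε => (hΦ ε hε).1.comp hηm
  refine ⟨fun ε ω => Φ ε fun i k => η i k ω, fun ε hε ω => ⟨fun t i => ?_, fun s t i j => ?_⟩,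
    hZm, ?_⟩
  · rw [((hΦ ε hε).2 _).1 t i, donskerPath_eq_noisePath hH' hε]
  · rw [((hΦ ε hε).2 _).2 s t i j, donskerArea_eq_noiseArea hH' hε]
  -- `b < H` leaves room for the dyadic union bound, `μ < b` gives compactness, and
  -- `1 / 2 - H < b` makes the compensated kernel integrable; such `b` exist because `1 / 4 < H`
  obtain ⟨b, hb1, hbH⟩ := exists_between (max_lt hμH (by linarith : 1 / 2 - H < H))
  have hμb : μ < b := (le_max_left _ _).trans_lt hb1
  have hb0 : 0 < b := hμ.trans hμb
  have hb : 0 < b + (H - 1 / 2) := by linarith [(le_max_right μ (1 / 2 - H)).trans_lt hb1]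
  -- the power of the tail bound for which an interval of length `2 ^ (-n)` fails with
  -- probability of order `4 ^ (-n)`
  obtain ⟨m, hm'⟩ := exists_nat_ge (1 / (H - b))
  have hm : 1 ≤ m * (H - b) := (div_le_iff₀ (sub_pos.2 hbH)).1 hm'
  have hm0 : m ≠ 0 := by rintro rfl; norm_num at hm
  -- the parameter of Hoeffding's lemma for a centred variable in `[-kη, kη]`
  let c : NNReal := (‖kη - -kη‖₊ / 2) ^ 2
  have hη : ∀ i k, HasSubgaussianMGF (η i k) c P := fun i k =>
    (hasSubgaussianMGF_of_mem_Icc_of_integral_eq_zero (hlaw i k).aemeasurable_snd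
      (hbdd.mono fun ω h => abs_le.1 h) hmean).congr_identDistrib (hlaw i k).symm
  let G₁ : ℝ := c / H
  let G₂ : ℝ := c * (chainConst b * (1 + |H - 1 / 2| / (b + (H - 1 / 2)))) ^ 2 / H
  have hG₁ : 0 ≤ G₁ := by positivity
  have hG₂ : 0 ≤ G₂ := by positivity
  have hG : 0 < G₁ + G₂ + 1 := by positivity
  rw [isTightMeasureSet_iff_exists_isCompact_measure_compl_le]
  intro ρ hρ
  have hlim := ENNReal.tendsto_ofReal
    (((tendsto_failureBound (G₁ + G₂ + 1) hm0).const_mul 2).const_mul ((d : ℝ) + d * d))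
  rw [mul_zero, mul_zero, ENNReal.ofReal_zero] at hlim
  obtain ⟨R, hRρ, hR⟩ := ((hlim.eventually_lt_const hρ).and (Filter.eventually_gt_atTop 0)).exists
  have hK : IsCompact (levelSet d μ b R) := isCompact_levelSet hμ hμb hR.le
  refine ⟨levelSet d μ b R, hK, ?_⟩
  rintro _ ⟨ε, hε, rfl⟩
  rw [Measure.map_apply (hZm ε hε) hK.isClosed.measurableSet.compl]
  have hsub : (fun ω => Φ ε fun i k => η i k ω) ⁻¹' (levelSet d μ b R)ᶜ ⊆
      {ω | ¬ GoodEvent H ε b R fun i k => η i k ω} := fun ω hω hgood =>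
    hω ⟨GoodEvent.mem_pathBall hgood hH' hε hb0 hR.le ((hΦ ε hε).2 _).1,
      GoodEvent.mem_areaBall hgood hH' hε hb0 hR.le ((hΦ ε hε).2 _).2⟩
  exact (measure_mono hsub).trans ((measure_not_goodEvent_le hmeas hindep hη hH0 hH' hε hb0 hb hR
    hG (by linarith : G₁ ≤ _) (by linarith : G₂ ≤ _) hm).trans hRρ.le)
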